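/- Let $X$ be a CAT(0) cube complex (that is, a simply connected cubical complex in which the link of every vertex is a flag complex). Identify $X$ with its one-skeleton, so that "$x\in X$" means that $x$ is a vertex, $d$ is the graph metric and $\mathrm{Isom}(X)$ is the automorphism group of this graph. Suppose that $X$ is uniformly locally finite, i.e. there is $N$ such that every vertex has at most $N$ neighbours. **Definitions.** A *hyperplane* is a class of edges for the equivalence relation generated by being opposite edges of a square; the *halfspaces* it delimits are the connected components of the graph obtained by removing its edges. An *orientation* is a set of halfspaces which contains exactly one of the halfspaces delimited by each hyperplane, and which contains every halfspace $B\supset A$ whenever it contains the halfspace $A$. The *Roller compactification* $\overline X$ is the set of orientations; a vertex $x$ is identified with the orientation consisting of the halfspaces containing $x$, and $\mathfrak RX=\overline X\setminus X$. The *cubical components* of $\overline X$ are the connected components of the graph on $\overline X$ in which two orientations are adjacent if their symmetric difference has exactly two elements. A hyperplane separates two orientations if they contain different halfspaces delimited by it; it separates a vertex $x$ from $Y \subset \overline X$ if one of its halfspaces contains $x$ and another one belongs to every element of $Y$. For a cubical component $Y\subset\mathfrak RX$ and a vertex $x$, the projection $\pi_Y(x)$ is the unique point $\eta\in Y$ such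 that the hyperplanes separating $x$ from $\eta$ are precisely the hyperplanes separating $x$ from $Y$. For vertices $x,y,z$, $\mu(x,y,z)$ is the unique vertex lying on geodesics between any two of $x,y,z$; for three points of $\overline X$, $\mu$ is the set of halfspaces that belong to at least two of them. A set of vertices is a *median subalgebra* if it is stable under $\mu$. For $\zeta,\xi\in\mathfrak RX$, $I(\zeta,\xi)$ denotes the set of vertices $x \in X$ with $\mu(x,\zeta,\xi)=x$. An *axis* of $g\in\mathrm{Isom}(X)$ is a bi-infinite geodesic $\gamma:\mathbb Z\to X$ on which $g$ acts by a non-trivial translation, and $g$ is *loxodromic* if it has an axis. The *points at infinity* of $\gamma$ are the sets $\zeta$ and $\xi$ of halfspaces containing $\gamma(i)$ for all sufficiently small, respectively all sufficiently large, $i \in \mathbb Z$. For $n \ge 1$ put $\mathrm{Min}(g^n)=\{x\in X\mid d(x,g^nx)=\inf_{y\in X}d(y,g^ny)\}$, and $\mathrm{SMin}(g)=\bigcup_{n\ge1}\mathrm{Min}(g^n)$. **Theorem.** Let $g\in\mathrm{Isom}(X)$ be loxodromic, let $\gamma$ be an axis of $g$ with points at infinity $\zeta,\xi$, and let $Y$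 be the cubical component of $\overline X$ containing $\xi$. Then $\zeta,\xi\in\mathfrak RX$, $Y\subset\mathfrak RX$, the projection $\pi_Y(x)$ exists and is unique for every vertex $x$, $\mathrm{SMin}(g)$ is a median subalgebra of $X$, and $$\mathrm{SMin}(g)\to Y\times I(\zeta,\xi),\qquad x\mapsto\bigl(\pi_Y(x),\mu(x,\zeta,\xi)\bigr)$$ is an isomorphism of median algebras: a bijection which carries $\mu$ on $\mathrm{SMin}(g)$ to the componentwise median on $Y\times I(\zeta,\xi)$. -/

import Mathlib

open Set Filter

/-- The face of the combinatorial cube `{0,1}^n` obtained by prescribing the coordinates `i` with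
`p i = some b` to be `b` and leaving the coordinates with `p i = none` free. -/
def cubeFace {n : ℕ} (p : Fin n → Option Bool) : Set (Fin n → Bool) :=
  {x | ∀ i b, p i = some b → x i = b}

/-- A cubical complex with vertex set `V`: every cube is recorded by its set of vertices, cubes are
embedded, faces of cubes are cubes, and two cubes that meet do so in a common face. -/
structure CubicalComplex (V : Type*) where
  /-- the (vertex sets of the) cubes -/
  cubes : Set (Set V)
  singleton_mem : ∀ v : V, {v} ∈ cubes
  /-- Each cube is a copy of some `{0,1}^n`, and the cubes contained in it are exactly its faces. -/
  exists_chart : ∀ C ∈ cubes, ∃ (n : ℕ) (e : (Fin n → Bool) → V),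
    Function.Injective e ∧ range e = C ∧
      ∀ D ⊆ C, (D ∈ cubes ↔ ∃ p : Fin n → Option Bool, D = e '' cubeFace p)
  inter_mem : ∀ C ∈ cubes, ∀ D ∈ cubes, (C ∩ D).Nonempty → C ∩ D ∈ cubes

namespace CubicalComplex

variable {V : Type*} (X : CubicalComplex V)

/-- The one-skeleton. -/
def skeleton : SimpleGraph V where
  Adj u v := u ≠ v ∧ {u, v} ∈ X.cubes
  symm := ⟨fun u v h => ⟨h.1.symm, by rw [Set.pair_comm]; exact h.2⟩⟩
  loopless := ⟨fun _ h => h.1 rfl⟩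

/-- `a, b, c, d` are the consecutive corners of a square (a `2`-cube) of `X`. -/
def IsSquare (a b c d : V) : Prop :=
  X.skeleton.Adj a b ∧ X.skeleton.Adj b c ∧ X.skeleton.Adj c d ∧ X.skeleton.Adj d a ∧
    a ≠ c ∧ b ≠ d ∧ {a, b, c, d} ∈ X.cubes

/-- Homotopy of edge-paths rel endpoints: generated by removing a backtrack and by pushing
a path of length two across a square. -/
inductive Homotopic : {u v : V} → X.skeleton.Walk u v → X.skeleton.Walk u v → Prop
  | refl {u v : V} (p : X.skeleton.Walk u v) : Homotopic p p
  | symm {u v : V} {p q : X.skeleton.Walk u v} : Homotopic p q → Homotopic q p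
  | trans {u v : V} {p q r : X.skeleton.Walk u v} :
      Homotopic p q → Homotopic q r → Homotopic p r
  | cons {u v w : V} (h : X.skeleton.Adj u v) {p q : X.skeleton.Walk v w} :
      Homotopic p q → Homotopic (.cons h p) (.cons h q)
  | backtrack {u v w : V} (h : X.skeleton.Adj u v) (h' : X.skeleton.Adj v u)
      (p : X.skeleton.Walk u w) : Homotopic (.cons h (.cons h' p)) p
  | square {a b c d w : V} (hab : X.skeleton.Adj a b) (hbc : X.skeleton.Adj b c)
      (had : X.skeleton.Adj a d) (hdc : X.skeleton.Adj d c) (hsq : X.IsSquare a b c d)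
      (p : X.skeleton.Walk c w) :
      Homotopic (.cons hab (.cons hbc p)) (.cons had (.cons hdc p))

/-- Connected, with trivial edge-path group. -/
def IsSimplyConnected : Prop :=
  X.skeleton.Connected ∧ ∀ (v : V) (p : X.skeleton.Walk v v), X.Homotopic p .nil

/-- The link of every vertex is flag: finitely many neighbours of `v` that pairwise span a square
with `v` all lie, together with `v`, in one cube. -/
def IsNonpositivelyCurved : Prop :=
  ∀ (v : V) (S : Finset V), (∀ a ∈ S, X.skeleton.Adj v a) →
    (∀ a ∈ S, ∀ b ∈ S, a ≠ b → ∃ c, X.IsSquare v a c b) →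
      ∃ C ∈ X.cubes, v ∈ C ∧ (S : Set V) ⊆ C

/-- `X` is a CAT(0) cube complex. -/
def IsCAT0 : Prop := X.IsNonpositivelyCurved ∧ X.IsSimplyConnected

def IsUniformlyLocallyFinite : Prop :=
  ∃ N : ℕ, ∀ v : V, (X.skeleton.neighborSet v).encard ≤ N

/-! ### Hyperplanes and halfspaces -/

/-- Two edges are opposite edges of a square. -/
def Parallel (e f : Sym2 V) : Prop :=
  ∃ a b c d : V, X.IsSquare a b c d ∧ e = s(a, b) ∧ f = s(d, c)

/-- A hyperplane is a class of edges for the equivalence relation generated by `Parallel`. -/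
def IsHyperplane (J : Set (Sym2 V)) : Prop :=
  ∃ e ∈ X.skeleton.edgeSet, J = {f | Relation.EqvGen X.Parallel e f}

/-- `A` is a connected component of the graph obtained by removing the edges of the
hyperplane `J`. -/
def Delimits (J : Set (Sym2 V)) (A : Set V) : Prop :=
  X.IsHyperplane J ∧ ∃ c : (X.skeleton.deleteEdges J).ConnectedComponent, A = c.supp

def IsHalfspace (A : Set V) : Prop := ∃ J, X.Delimits J A

/-! ### The Roller compactification -/

/-- An orientation is a set of halfspaces, containing exactly one of the halfspaces delimited by
each hyperplane, and upward closed among halfspaces. -/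
structure IsOrientation (σ : Set (Set V)) : Prop where
  isHalfspace : ∀ A ∈ σ, X.IsHalfspace A
  existsUnique : ∀ J, X.IsHyperplane J → ∃! A, X.Delimits J A ∧ A ∈ σ
  upward : ∀ A B, X.IsHalfspace A → X.IsHalfspace B → A ⊆ B → A ∈ σ → B ∈ σ

/-- The Roller compactification, as a set of sets of halfspaces. -/
def roller : Set (Set (Set V)) := {σ | X.IsOrientation σ}

/-- The principal orientation of a vertex; through it `V` is identified with a subset of
the Roller compactification. -/
def principal (x : V) : Set (Set V) := {A | X.IsHalfspace A ∧ x ∈ A}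

def rollerBoundary : Set (Set (Set V)) := X.roller \ range X.principal

/-- The cubical component of `ξ`: the orientations joined to `ξ` by a finite chain of orientations
in which any two consecutive ones have symmetric difference of cardinality two. -/
def cubicalComponent (ξ : Set (Set V)) : Set (Set (Set V)) :=
  {η | η ∈ X.roller ∧ Relation.ReflTransGen
    (fun σ τ => σ ∈ X.roller ∧ τ ∈ X.roller ∧ (symmDiff σ τ).encard = 2) ξ η}

/-- `J` separates the vertex `x` from the set `Y` of orientations. -/
def SeparatesFrom (J : Set (Sym2 V)) (x : V) (Y : Set (Set (Set V))) : Prop :=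
  ∃ A B, X.Delimits J A ∧ X.Delimits J B ∧ A ≠ B ∧ A ∈ X.principal x ∧ ∀ η ∈ Y, B ∈ η

/-- `η` is the projection of `x` onto `Y`: it lies in `Y`, and the hyperplanes separating `x` from
`η` are precisely those separating `x` from `Y`. -/
def IsProjection (Y : Set (Set (Set V))) (x : V) (η : Set (Set V)) : Prop :=
  η ∈ Y ∧ ∀ J, X.SeparatesFrom J x {η} ↔ X.SeparatesFrom J x Y

/-- The projection `π_Y` onto a cubical component `Y`. -/
noncomputable def proj (Y : Set (Set (Set V))) (x : V) : Set (Set V) :=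
  Classical.epsilon (X.IsProjection Y x)

/-! ### Medians -/

/-- `m` lies on geodesics between any two of `x, y, z`. -/
def IsMedianPoint (x y z m : V) : Prop :=
  X.skeleton.dist x y = X.skeleton.dist x m + X.skeleton.dist m y ∧
  X.skeleton.dist x z = X.skeleton.dist x m + X.skeleton.dist m z ∧
  X.skeleton.dist y z = X.skeleton.dist y m + X.skeleton.dist m z

/-- The median point of three vertices. -/
noncomputable def median (x y z : V) : V :=
  @Classical.epsilon V ⟨x⟩ (X.IsMedianPoint x y z)

def IsMedianSubalgebra (S : Set V) : Prop :=
  ∀ x ∈ S, ∀ y ∈ S, ∀ z ∈ S, X.median x y z ∈ S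

/-- The median of three points of the Roller compactification: it consists of the halfspaces
that belong to at least two of them. -/
def rollerMedian (ρ σ τ : Set (Set V)) : Set (Set V) := (ρ ∩ σ) ∪ (ρ ∩ τ) ∪ (σ ∩ τ)

/-- The (principal orientations of the) vertices of `X` lying in the interval between two points
of the Roller compactification. -/
def interval (ζ ξ : Set (Set V)) : Set (Set (Set V)) :=
  {σ | σ ∈ range X.principal ∧ rollerMedian σ ζ ξ = σ}

/-! ### Isometries -/

/-- `γ` is a bi-infinite geodesic on which `g` acts as a non-trivial translation. -/
def IsAxis (g : X.skeleton ≃g X.skeleton) (γ : ℤ → V) : Prop :=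
  (∀ i j, (X.skeleton.dist (γ i) (γ j) : ℤ) = |i - j|) ∧
    ∃ τ : ℤ, τ ≠ 0 ∧ ∀ i, g (γ i) = γ (i + τ)

def IsLoxodromic (g : X.skeleton ≃g X.skeleton) : Prop := ∃ γ : ℤ → V, X.IsAxis g γ

/-- The minimising set. -/
def minSet (g : X.skeleton ≃g X.skeleton) : Set V :=
  {x | X.skeleton.dist x (g x) = ⨅ y, X.skeleton.dist y (g y)}

/-- The stable minimising set. -/
def stableMinSet (g : X.skeleton ≃g X.skeleton) : Set V :=
  ⋃ n : ℕ, ⋃ _ : 1 ≤ n, X.minSet (g ^ n)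

/-- The point at infinity of `γ` along `l` (`l = atTop` or `l = atBot`): the halfspaces that
eventually contain `γ`. -/
def endpoint (γ : ℤ → V) (l : Filter ℤ) : Set (Set V) :=
  {A | X.IsHalfspace A ∧ ∀ᶠ i in l, γ i ∈ A}

end CubicalComplex

/-- `f` restricts to an isomorphism from `S`, with the operation `μ`, onto `T`, with the
operation `ν`. -/
def IsMedianIsomorphism {α β : Type*} (μ : α → α → α → α) (ν : β → β → β → β)
    (S : Set α) (T : Set β) (f : α → β) : Prop :=
  BijOn f S T ∧ ∀ x ∈ S, ∀ y ∈ S, ∀ z ∈ S, f (μ x y z) = ν (f x) (f y) (f z)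

/-- The componentwise ternary operation on a product. -/
def prodMedian {α β : Type*} (μ : α → α → α → α) (ν : β → β → β → β) (x y z : α × β) : α × β :=
  (μ x.1 y.1 z.1, ν x.2 y.2 z.2)

/-!
The proof has three layers.

*The one-skeleton is a median graph.* Fix a vertex `o` and consider edge-walks ending at `o`. A
`Ladder` records that the first edge of a walk, up to square pushes, can be chosen to be a given
edge: that edge is carried along a strip of squares until it becomes an edge of the walk. Flagness
of links makes ladders survive square pushes (`Ladder.transport_swap`), and processing
a walk edge by edge, cancelling along ladders, produces a normal form which is well defined up to
square pushes and invariant under homotopy (`Homotopic.swapEq`). Since all walks between two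
vertices are homotopic, any two geodesics with the same ends differ by square pushes
(`IsCAT0.swapEq_of_geodesic`). This gives the quadrangle condition (`IsCAT0.quadrangle`), hence
the existence of medians, and the identification of the halfspaces with the sets of vertices
closer to one end of an edge than to the other. Halfspaces are convex, and distances count the
halfspaces separating two vertices (`IsCAT0.encard_separators`).

*Orientations.* An orientation that differs from a vertex on finitely many hyperplanes is a vertex
(`IsOrientation.exists_eq_principal`), and a cubical component consists of the orientations that
differ from a given one on finitely many hyperplanes (`IsCAT0.mem_cubicalComponent_iff`). All
vertices needed later are constructed by writing down an orientation.

*Dynamics.* Up to replacing `g` by its inverse, `g` moves the axis towards `ξ`. Call a halfspace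
crossed if it belongs to exactly one of `ζ`, `ξ`. A vertex `x` minimises the displacement of
`g^n` exactly when every halfspace containing `g^n x` but not `x` is crossed and belongs to `ξ`
(`IsPositiveAxis.mem_minSet_iff_halfspaces`); stability under medians follows at once. If `η` is
in the cubical component `Y` of `ξ`, the halfspaces in `η` but not in `ξ` stay at bounded distance
from the axis, so by local finiteness each of them is invariant under a power of `g`
(`IsPositiveAxis.exists_periodic`), and in particular is not crossed. On the other hand, no orbit
of a power of `g` stays in a crossed halfspace. Thus a vertex `x` of the stable minimising set
amounts to two independent choices: its sides of the crossed hyperplanes, recorded by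
`μ(x, ζ, ξ)`, and its sides of the other ones, recorded by `π_Y(x)`. Every pair of choices occurs
(`IsPositiveAxis.exists_mem_stableMinSet`): the two prescriptions combine to an orientation near a
vertex, and some power of `g` fixes `η` and maps each crossed halfspace of `ξ` into itself,
because pairwise incomparable halfspaces crossed by the axis are at most as many as the bound on
the degrees (`IsCAT0.card_le_of_incomparable`).
-/

namespace CubicalComplex

variable {V : Type*} {X : CubicalComplex V}

/-! ### Squares and cubes -/

theorem IsSquare.rotate {a b c d : V} (h : X.IsSquare a b c d) : X.IsSquare b c d a := by
  obtain ⟨h1, h2, h3, h4, h5, h6, h7⟩ := h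
  refine ⟨h2, h3, h4, h1, h6, h5.symm, ?_⟩
  convert h7 using 1
  ext x; simp only [mem_insert_iff, mem_singleton_iff]; tauto

theorem IsSquare.reflect {a b c d : V} (h : X.IsSquare a b c d) : X.IsSquare a d c b := by
  obtain ⟨h1, h2, h3, h4, h5, h6, h7⟩ := h
  refine ⟨h4.symm, h3.symm, h2.symm, h1.symm, h5, h6.symm, ?_⟩
  convert h7 using 1
  ext x; simp only [mem_insert_iff, mem_singleton_iff]; tauto

/-- The number of vertices of a cube is a power of two. -/
theorem exists_ncard_eq_two_pow {C : Set V} (hC : C ∈ X.cubes) : ∃ n : ℕ, C.ncard = 2 ^ n := by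
  obtain ⟨n, e, he, rfl, -⟩ := X.exists_chart C hC
  refine ⟨n, ?_⟩
  rw [← image_univ, ncard_image_of_injective _ he, ncard_univ]
  simp

/-- A cube containing three vertices of a square contains the fourth. -/
theorem IsSquare.mem_of_mem {a b c d : V} (h : X.IsSquare a b c d) {C : Set V} (hC : C ∈ X.cubes)
    (ha : a ∈ C) (hb : b ∈ C) (hc : c ∈ C) : d ∈ C := by
  by_contra hd
  obtain ⟨n, hn⟩ := exists_ncard_eq_two_pow
    (X.inter_mem _ h.2.2.2.2.2.2 _ hC ⟨a, by simp, ha⟩)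
  have hset : ({a, b, c, d} : Set V) ∩ C = {a, b, c} := by
    ext x
    simp only [mem_inter_iff, mem_insert_iff, mem_singleton_iff]
    constructor
    · rintro ⟨rfl | rfl | rfl | rfl, hx⟩ <;> simp_all
    · rintro (rfl | rfl | rfl) <;> simp_all
  have h3 : ({a, b, c} : Set V).ncard = 3 :=
    ncard_eq_three.mpr ⟨a, b, c, h.1.ne, h.2.2.2.2.1, h.2.1.ne, rfl⟩
  rw [hset, h3] at hn
  rcases n with _ | _ | n
  · omega
  · omega
  · rw [pow_succ, pow_succ] at hn; omega

theorem IsSquare.unique {a b c d d' : V} (h : X.IsSquare a b c d) (h' : X.IsSquare a b c d') :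
    d = d' := by
  have := h.mem_of_mem h'.2.2.2.2.2.2 (by simp) (by simp) (by simp)
  simp only [mem_insert_iff, mem_singleton_iff] at this
  rcases this with r | r | r | r
  · exact absurd r h.2.2.2.1.ne
  · exact absurd r.symm h.2.2.2.2.2.1
  · exact absurd r.symm h.2.2.1.ne
  · exact r

theorem IsSquare.unique_opposite {a b c c' d : V} (h : X.IsSquare a b c d)
    (h' : X.IsSquare a b c' d) : c = c' :=
  h.rotate.rotate.rotate.unique h'.rotate.rotate.rotate

/-! ### Charts of cubes -/

/-- Flipping one coordinate of a vertex of `{0,1}^n`. -/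
def flipAt {n : ℕ} (i : Fin n) (x : Fin n → Bool) : Fin n → Bool := Function.update x i (!x i)

theorem flipAt_apply {n : ℕ} (i j : Fin n) (x : Fin n → Bool) :
    flipAt i x j = if j = i then !x i else x j := by
  rw [flipAt, Function.update_apply]

theorem flipAt_comm {n : ℕ} (i j : Fin n) (x : Fin n → Bool) :
    flipAt i (flipAt j x) = flipAt j (flipAt i x) := by
  ext k
  grind [flipAt_apply]

theorem flipAt_ne {n : ℕ} (i : Fin n) (x : Fin n → Bool) : flipAt i x ≠ x := fun h => by
  have := congrFun h i
  simp [flipAt_apply] at this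

section chart

variable {C : Set V} {n : ℕ} {e : (Fin n → Bool) → V} (he : Function.Injective e)
  (hC : range e = C)
  (hf : ∀ D ⊆ C, (D ∈ X.cubes ↔ ∃ p : Fin n → Option Bool, D = e '' cubeFace p))
include he hC hf

theorem chart_adj (i : Fin n) (x : Fin n → Bool) : X.skeleton.Adj (e x) (e (flipAt i x)) := by
  refine ⟨fun h => flipAt_ne i x (he h).symm, ?_⟩
  rw [hf _ (by rw [← hC]; rintro _ (rfl | rfl) <;> exact mem_range_self _)]
  refine ⟨fun k => if k = i then none else some (x k), ?_⟩
  rw [← image_pair]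
  congr 1
  ext y
  simp only [mem_insert_iff, mem_singleton_iff, cubeFace, mem_ofPred_eq]
  constructor
  · rintro (rfl | rfl) k b hk
    · split_ifs at hk; simpa using hk
    · split_ifs at hk with h; simpa [flipAt_apply, h] using hk
  · intro h
    by_cases hi : y i = x i
    · left; ext k
      by_cases hk : k = i
      · rw [hk, hi]
      · rw [h k (x k) (by simp [hk])]
    · right; ext k
      by_cases hk : k = i
      · subst hk; simp [flipAt_apply, Bool.eq_not_of_ne hi]
      · rw [h k (x k) (by simp [hk])]; simp [flipAt_apply, hk]

theorem chart_square {i j : Fin n} (hij : i ≠ j) (x : Fin n → Bool) :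
    X.IsSquare (e x) (e (flipAt i x)) (e (flipAt j (flipAt i x))) (e (flipAt j x)) := by
  have hne : flipAt j (flipAt i x) ≠ x := fun h => by
    have := congrFun h i
    simp [flipAt_apply, hij] at this
  have hne' : flipAt i x ≠ flipAt j x := fun h => by
    have := congrFun h i
    simp [flipAt_apply, hij] at this
  refine ⟨chart_adj he hC hf _ _, chart_adj he hC hf _ _, ?_, (chart_adj he hC hf _ _).symm,
    fun h => hne (he h).symm, fun h => hne' (he h), ?_⟩
  · rw [flipAt_comm]; exact (chart_adj he hC hf _ _).symm
  rw [hf _ (by rw [← hC]; rintro _ (rfl | rfl | rfl | rfl) <;> exact mem_range_self _)]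
  refine ⟨fun k => if k = i ∨ k = j then none else some (x k), ?_⟩
  rw [show ({e x, e (flipAt i x), e (flipAt j (flipAt i x)), e (flipAt j x)} : Set V) =
    e '' {x, flipAt i x, flipAt j (flipAt i x), flipAt j x} by simp [image_insert_eq]]
  congr 1
  ext y
  simp only [mem_insert_iff, mem_singleton_iff, cubeFace, mem_ofPred_eq]
  constructor
  · rintro (rfl | rfl | rfl | rfl) k b hk <;> split_ifs at hk with h <;>
      rw [not_or] at h <;> simpa [flipAt_apply, h.1, h.2] using hk
  · intro h
    have hk : ∀ k, k ≠ i → k ≠ j → y k = x k := fun k h1 h2 => h k _ (by simp [h1, h2])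
    by_cases hi : y i = x i <;> by_cases hj : y j = x j
    · left; ext k
      by_cases h1 : k = i
      · rw [h1, hi]
      by_cases h2 : k = j
      · rw [h2, hj]
      rw [hk k h1 h2]
    · right; right; right; ext k
      by_cases h2 : k = j
      · subst h2; simp [flipAt_apply, Bool.eq_not_of_ne hj]
      by_cases h1 : k = i
      · subst h1; simp [flipAt_apply, hi, h2]
      rw [hk k h1 h2]; simp [flipAt_apply, h2]
    · right; left; ext k
      by_cases h1 : k = i
      · subst h1; simp [flipAt_apply, Bool.eq_not_of_ne hi]
      by_cases h2 : k = j
      · subst h2; simp [flipAt_apply, hj, h1]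
      rw [hk k h1 h2]; simp [flipAt_apply, h1]
    · right; right; left; ext k
      by_cases h1 : k = i
      · subst h1; simp [flipAt_apply, Bool.eq_not_of_ne hi, hij]
      by_cases h2 : k = j
      · subst h2; simp [flipAt_apply, Bool.eq_not_of_ne hj, h1]
      rw [hk k h1 h2]; simp [flipAt_apply, h1, h2]

theorem chart_exists_flipAt (x : Fin n → Bool) {a : V} (ha : a ∈ C)
    (h : X.skeleton.Adj (e x) a) : ∃ i, a = e (flipAt i x) := by
  subst hC
  obtain ⟨y, rfl⟩ := ha
  obtain ⟨p, hp⟩ := (hf {e x, e y} (by rintro _ (rfl | rfl) <;> exact mem_range_self _)).1 h.2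
  rw [← image_pair, he.image_injective.eq_iff] at hp
  have hx : x ∈ cubeFace p := hp ▸ by simp
  have hy : y ∈ cubeFace p := hp ▸ by simp
  obtain ⟨i, hi⟩ : ∃ i, x i ≠ y i := by
    by_contra! hxy
    exact h.ne (congrArg e (funext hxy))
  have hflip : flipAt i x ∈ cubeFace p := by
    intro k b hk
    by_cases hki : k = i
    · subst hki; exact absurd ((hx k b hk).trans (hy k b hk).symm) hi
    · simpa [flipAt_apply, hki] using hx k b hk
  rw [← hp] at hflip
  rcases hflip with hflip | hflip
  · exact absurd hflip (flipAt_ne i x)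
  · exact ⟨i, by rw [hflip]⟩

end chart

/-- Three squares pairwise sharing an edge at `b` are faces of a three-dimensional cube; `w` is the
vertex of that cube opposite to `b`. -/
theorem IsNonpositivelyCurved.exists_cube (hX : X.IsNonpositivelyCurved) {a b c f d u t : V}
    (h1 : X.IsSquare b a d c) (h2 : X.IsSquare b a u f) (h3 : X.IsSquare b c t f) :
    ∃ w, X.IsSquare d c t w ∧ X.IsSquare a d w u ∧ X.IsSquare u f t w := by
  classical
  obtain ⟨C, hC, hb, hS⟩ := hX b {a, c, f}
    (by simp only [Finset.mem_insert, Finset.mem_singleton]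
        rintro _ (rfl | rfl | rfl)
        · exact h1.1
        · exact h1.2.2.2.1.symm
        · exact h2.2.2.2.1.symm)
    (by simp only [Finset.mem_insert, Finset.mem_singleton]
        rintro _ (rfl | rfl | rfl) _ (rfl | rfl | rfl) hne
        · exact absurd rfl hne
        · exact ⟨d, h1⟩
        · exact ⟨u, h2⟩
        · exact ⟨d, h1.reflect⟩
        · exact absurd rfl hne
        · exact ⟨t, h3⟩
        · exact ⟨u, h2.reflect⟩
        · exact ⟨t, h3.reflect⟩
        · exact absurd rfl hne)
  obtain ⟨n, e, he, hr, hf⟩ := X.exists_chart C hC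
  obtain ⟨x, rfl⟩ : b ∈ range e := hr ▸ hb
  obtain ⟨i, rfl⟩ := chart_exists_flipAt he hr hf x (hS (by simp)) h1.1
  obtain ⟨j, rfl⟩ := chart_exists_flipAt he hr hf x (hS (by simp)) h1.2.2.2.1.symm
  obtain ⟨k, rfl⟩ := chart_exists_flipAt he hr hf x (hS (by simp)) h2.2.2.2.1.symm
  have hij : i ≠ j := fun h => h1.2.2.2.2.2.1 (by rw [h])
  have hik : i ≠ k := fun h => h2.2.2.2.2.2.1 (by rw [h])
  have hjk : j ≠ k := fun h => h3.2.2.2.2.2.1 (by rw [h])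
  have key := fun {p q : Fin n} (h : p ≠ q) y => chart_square he hr hf h y
  obtain rfl := h1.unique_opposite (key hij x)
  obtain rfl := h2.unique_opposite (key hik x)
  obtain rfl := h3.unique_opposite (key hjk x)
  refine ⟨e (flipAt k (flipAt j (flipAt i x))), ?_, key hjk _, ?_⟩
  · have := (key hik.symm (flipAt j x)).rotate.rotate.rotate
    rwa [flipAt_comm i k, flipAt_comm i j] at this
  · have := (key hij.symm (flipAt k x)).rotate.rotate.rotate
    rwa [flipAt_comm i j, flipAt_comm i k, flipAt_comm j k, flipAt_comm j k] at this

/-! ### Square pushes and ladders -/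

section walks

variable {o : V}

/-- One square push somewhere along a walk. -/
inductive Swap : {u : V} → X.skeleton.Walk u o → X.skeleton.Walk u o → Prop
  | head {a b c d : V} (hab : X.skeleton.Adj a b) (hbc : X.skeleton.Adj b c)
      (had : X.skeleton.Adj a d) (hdc : X.skeleton.Adj d c) (hsq : X.IsSquare a b c d)
      (r : X.skeleton.Walk c o) : Swap (.cons hab (.cons hbc r)) (.cons had (.cons hdc r))
  | cons {u v : V} (h : X.skeleton.Adj u v) {p q : X.skeleton.Walk v o} :
      Swap p q → Swap (.cons h p) (.cons h q)

/-- Walks that differ by square pushes. -/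
def SwapEq {u : V} (p q : X.skeleton.Walk u o) : Prop := Relation.ReflTransGen Swap p q

/-- `Ladder p q` holds when the edge joining the start of `p` to the start of `q` can be carried
along a strip of squares until it becomes an edge of `p`, and `q` is obtained from `p` by following
the other side of the strip. So `p` is, up to square pushes, that edge followed by `q`. -/
inductive Ladder : {u v : V} → X.skeleton.Walk u o → X.skeleton.Walk v o → Prop
  | base {u v : V} (h : X.skeleton.Adj u v) (q : X.skeleton.Walk v o) : Ladder (.cons h q) q
  | step {u v u' v' : V} (hu : X.skeleton.Adj u' u) (hv : X.skeleton.Adj v' v)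
      {p : X.skeleton.Walk u o} {q : X.skeleton.Walk v o} :
      X.IsSquare u v v' u' → Ladder p q → Ladder (.cons hu p) (.cons hv q)

theorem Swap.symm {u : V} {p q : X.skeleton.Walk u o} (h : Swap p q) : Swap q p := by
  induction h with
  | head hab hbc had hdc hsq r => exact .head _ _ _ _ hsq.reflect r
  | cons h _ ih => exact .cons h ih

theorem Swap.length_eq {u : V} {p q : X.skeleton.Walk u o} (h : Swap p q) :
    p.length = q.length := by
  induction h with
  | head => rfl
  | cons h _ ih => simp [ih]

theorem SwapEq.refl {u : V} (p : X.skeleton.Walk u o) : SwapEq p p := Relation.ReflTransGen.refl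

theorem SwapEq.trans {u : V} {p q r : X.skeleton.Walk u o} (h : SwapEq p q) (h' : SwapEq q r) :
    SwapEq p r := Relation.ReflTransGen.trans h h'

theorem SwapEq.symm {u : V} {p q : X.skeleton.Walk u o} (h : SwapEq p q) : SwapEq q p := by
  induction h with
  | refl => exact .refl _
  | tail _ h ih => exact .head h.symm ih

theorem SwapEq.cons {u v : V} (h : X.skeleton.Adj u v) {p q : X.skeleton.Walk v o}
    (hpq : SwapEq p q) : SwapEq (.cons h p) (.cons h q) := by
  induction hpq with
  | refl => exact .refl _
  | tail _ h' ih => exact .tail ih (.cons h h')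

theorem SwapEq.length_eq {u : V} {p q : X.skeleton.Walk u o} (h : SwapEq p q) :
    p.length = q.length := by
  induction h with
  | refl => rfl
  | tail _ h ih => exact ih.trans h.length_eq

theorem Ladder.adj {u v : V} {p : X.skeleton.Walk u o} {q : X.skeleton.Walk v o}
    (h : Ladder p q) : X.skeleton.Adj u v := by
  cases h with
  | base h q => exact h
  | step hu hv hs _ => exact hs.2.2.1.symm

theorem Ladder.swapEq {u v : V} {p : X.skeleton.Walk u o} {q : X.skeleton.Walk v o}
    (h : Ladder p q) (huv : X.skeleton.Adj u v) : SwapEq p (.cons huv q) := by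
  induction h with
  | base h q => exact .refl _
  | step hu hv hs _ ih => exact (ih hs.1).cons hu |>.tail (.head _ _ _ _ hs.rotate.rotate.rotate _)

theorem Ladder.length_eq {u v : V} {p : X.skeleton.Walk u o} {q : X.skeleton.Walk v o}
    (h : Ladder p q) : p.length = q.length + 1 := (h.swapEq h.adj).length_eq

/-- The top of a ladder determines the ladder, because a square is determined by three of its
vertices. -/
theorem Ladder.unique {u v : V} {p : X.skeleton.Walk u o} {q q' : X.skeleton.Walk v o}
    (h : Ladder p q) (h' : Ladder p q') : q = q' := by
  induction h with
  | base h q =>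
    cases h' with
    | base => rfl
    | step hu hv hs _ => exact absurd rfl hs.2.2.2.2.1
  | step hu hv hs _ ih =>
    cases h' with
    | base => exact absurd rfl hs.2.2.2.2.1
    | step hu hv' hs' hl =>
      obtain rfl := hs.rotate.rotate.unique hs'.rotate.rotate
      rw [ih hl]

theorem Ladder.transport_swap (hX : X.IsNonpositivelyCurved) {u v : V} {p p' : X.skeleton.Walk u o}
    {q : X.skeleton.Walk v o} (h : Ladder p q) (hp : Swap p p') :
    ∃ q', Ladder p' q' ∧ SwapEq q q' := by
  induction hp generalizing v with
  | cons hu hp ih =>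
    cases h with
    | base => exact ⟨_, .base _ _, .tail .refl hp⟩
    | step hu hv hs hl =>
      obtain ⟨q', hq', he⟩ := ih hl
      exact ⟨_, .step hu hv hs hq', he.cons hv⟩
  | head hab hbc had hdc hsq r =>
    cases h with
    | base => exact ⟨_, .step _ _ hsq.reflect.rotate (.base _ _), .refl _⟩
    | step hu hv hs hl =>
      cases hl with
      | base =>
        obtain rfl := hsq.rotate.unique_opposite hs
        exact ⟨_, .base _ _, .refl _⟩
      | step hu' hv' hs' hl' =>
        -- The three squares around the middle vertex of the push lie in a cube.
        obtain ⟨w, h1, h2, h3⟩ :=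
          hX.exists_cube hsq.rotate.reflect hs.reflect hs'.rotate.rotate.rotate
        exact ⟨_, .step _ h2.2.2.1.symm h2.rotate (.step _ h1.2.2.1.symm h1.rotate hl'),
          .tail .refl (.head _ _ _ _ h3 _)⟩

theorem Ladder.transport (hX : X.IsNonpositivelyCurved) {u v : V} {p p' : X.skeleton.Walk u o}
    {q : X.skeleton.Walk v o} (h : Ladder p q) (hp : SwapEq p p') :
    ∃ q', Ladder p' q' ∧ SwapEq q q' := by
  induction hp with
  | refl => exact ⟨q, h, .refl _⟩
  | tail _ hs ih =>
    obtain ⟨q', hq', he⟩ := ih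
    obtain ⟨q'', hq'', he'⟩ := hq'.transport_swap hX hs
    exact ⟨q'', hq'', he.trans he'⟩

/-! ### Normal forms of walks -/

/-- No edge of the walk can be cancelled against a ladder of the part of the walk following it. -/
inductive Reduced : {u : V} → X.skeleton.Walk u o → Prop
  | nil : Reduced .nil
  | cons {u v : V} (h : X.skeleton.Adj u v) {p : X.skeleton.Walk v o} : Reduced p →
      (∀ q : X.skeleton.Walk u o, ¬ Ladder p q) → Reduced (.cons h p)

theorem Reduced.transport_swap (hX : X.IsNonpositivelyCurved) {u : V} {p p' : X.skeleton.Walk u o}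
    (h : Reduced p) (hp : Swap p p') : Reduced p' := by
  induction hp with
  | cons hu hp ih =>
    cases h with
    | cons _ h hn =>
      refine .cons _ (ih h) fun q hq => ?_
      obtain ⟨q', hq', -⟩ := hq.transport_swap hX hp.symm
      exact hn q' hq'
  | head hab hbc had hdc hsq r =>
    cases h with
    | cons _ h hn =>
      cases h with
      | cons _ h hn' =>
        refine .cons _ (.cons _ h fun q hq => ?_) fun q hq => ?_
        · exact hn _ (.step _ had hsq.rotate.rotate hq)
        · cases hq with
          | base => exact hsq.2.2.2.2.1 rfl
          | step hu hv hs hl =>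
            obtain rfl := hs.rotate.rotate.rotate.unique_opposite hsq.reflect.rotate
            exact hn' _ hl

theorem Reduced.transport (hX : X.IsNonpositivelyCurved) {u : V} {p p' : X.skeleton.Walk u o}
    (h : Reduced p) (hp : SwapEq p p') : Reduced p' := by
  induction hp with
  | refl => exact h
  | tail _ hs ih => exact ih.transport_swap hX hs

theorem Reduced.of_ladder (hX : X.IsNonpositivelyCurved) {u v : V} {p : X.skeleton.Walk u o}
    {q : X.skeleton.Walk v o} (h : Reduced p) (hl : Ladder p q) :
    Reduced q ∧ ∀ q' : X.skeleton.Walk u o, ¬ Ladder q q' := by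
  cases h.transport hX (hl.swapEq hl.adj) with
  | cons _ h hn => exact ⟨h, hn⟩

/-- `NormalForm p r`: processing the edges of `p` one at a time, starting from the end `o`, each
cancelling against a ladder whenever there is one, yields `r`. -/
inductive NormalForm : {u : V} → X.skeleton.Walk u o → X.skeleton.Walk u o → Prop
  | nil : NormalForm .nil .nil
  | push {u v : V} (h : X.skeleton.Adj u v) {p r : X.skeleton.Walk v o} : NormalForm p r →
      (∀ q : X.skeleton.Walk u o, ¬ Ladder r q) → NormalForm (.cons h p) (.cons h r)
  | cancel {u v : V} (h : X.skeleton.Adj u v) {p r : X.skeleton.Walk v o}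
      {q : X.skeleton.Walk u o} : NormalForm p r → Ladder r q → NormalForm (.cons h p) q

theorem NormalForm.reduced (hX : X.IsNonpositivelyCurved) {u : V} {p r : X.skeleton.Walk u o}
    (h : NormalForm p r) : Reduced r := by
  induction h with
  | nil => exact .nil
  | push h _ hn ih => exact .cons h ih hn
  | cancel h _ hl ih => exact (ih.of_ladder hX hl).1

theorem NormalForm.exists {u : V} (p : X.skeleton.Walk u o) : ∃ r, NormalForm p r := by
  induction p with
  | nil => exact ⟨_, .nil⟩
  | @cons u v w h p ih =>
    obtain ⟨r, hr⟩ := ih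
    by_cases hl : ∃ q : X.skeleton.Walk u w, Ladder r q
    · obtain ⟨q, hq⟩ := hl
      exact ⟨q, .cancel h hr hq⟩
    · exact ⟨_, .push h hr fun q hq => hl ⟨q, hq⟩⟩

theorem NormalForm.cons_congr (hX : X.IsNonpositivelyCurved) {u v : V} (h : X.skeleton.Adj u v)
    {p p' : X.skeleton.Walk v o}
    (hp : ∀ r r', NormalForm p r → NormalForm p' r' → SwapEq r r') {s s' : X.skeleton.Walk u o}
    (hs : NormalForm (.cons h p) s) (hs' : NormalForm (.cons h p') s') : SwapEq s s' := by
  cases hs with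
  | push _ hr hn =>
    cases hs' with
    | push _ hr' hn' => exact (hp _ _ hr hr').cons h
    | cancel _ hr' hl' =>
      obtain ⟨q, hq, -⟩ := hl'.transport hX (hp _ _ hr hr').symm
      exact absurd hq (hn q)
  | cancel _ hr hl =>
    obtain h := hl
    cases hs' with
    | push _ hr' hn' =>
      obtain ⟨q, hq, -⟩ := hl.transport hX (hp _ _ hr hr')
      exact absurd hq (hn' q)
    | cancel _ hr' hl' =>
      obtain ⟨q, hq, he⟩ := hl.transport hX (hp _ _ hr hr')
      rwa [hq.unique hl'] at he

theorem NormalForm.unique (hX : X.IsNonpositivelyCurved) {u : V} (p : X.skeleton.Walk u o) :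
    ∀ r r', NormalForm p r → NormalForm p r' → SwapEq r r' := by
  induction p with
  | nil =>
    intro r r' h h'
    cases h; cases h'; exact .refl _
  | cons h p ih => exact fun r r' hr hr' => hr.cons_congr hX h ih hr'

theorem NormalForm.backtrack (hX : X.IsNonpositivelyCurved) {u v : V} (h : X.skeleton.Adj u v)
    (h' : X.skeleton.Adj v u) {p r : X.skeleton.Walk u o} (hp : NormalForm p r) :
    ∃ r', NormalForm (.cons h (.cons h' p)) r' ∧ SwapEq r' r := by
  by_cases hl : ∃ q : X.skeleton.Walk v o, Ladder r q
  · obtain ⟨q, hq⟩ := hl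
    exact ⟨_, .push h (.cancel h' hp hq) ((hp.reduced hX).of_ladder hX hq).2, (hq.swapEq h).symm⟩
  · exact ⟨_, .cancel h (.push h' hp fun q hq => hl ⟨q, hq⟩) (.base h' r), .refl _⟩

/-- The two ways around a square `a b c d` have a common normal form when the edge from `b` to `c`
cancels and the edge from `d` to `c` does not. -/
theorem NormalForm.square_aux (hX : X.IsNonpositivelyCurved) {a b c d : V}
    (hab : X.skeleton.Adj a b) (hbc : X.skeleton.Adj b c)
    (had : X.skeleton.Adj a d) (hdc : X.skeleton.Adj d c) (hsq : X.IsSquare a b c d)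
    {p r : X.skeleton.Walk c o} (hp : NormalForm p r) {q : X.skeleton.Walk b o} (hq : Ladder r q)
    (hd : ∀ q : X.skeleton.Walk d o, ¬ Ladder r q) :
    NormalForm (.cons hab (.cons hbc p)) (.cons hab q) ∧
      NormalForm (.cons had (.cons hdc p)) (.cons hab q) := by
  refine ⟨.push _ (.cancel _ hp hq) fun q' hq' => ?_,
    .cancel _ (.push _ hp hd) (.step _ _ hsq.rotate.rotate.reflect hq)⟩
  -- A ladder of `q` towards `a` would give a ladder of `r` towards `d`.
  have h1 : SwapEq r (.cons hdc.symm (.cons had.symm q')) :=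
    ((hq.swapEq hbc.symm).trans ((hq'.swapEq hab.symm).cons _)).tail
      (.head _ _ _ _ hsq.rotate.rotate.reflect _)
  obtain ⟨s, hs, -⟩ := (Ladder.base hdc.symm (.cons had.symm q')).transport hX h1.symm
  exact hd s hs

theorem NormalForm.square (hX : X.IsNonpositivelyCurved) {a b c d : V}
    (hab : X.skeleton.Adj a b) (hbc : X.skeleton.Adj b c)
    (had : X.skeleton.Adj a d) (hdc : X.skeleton.Adj d c) (hsq : X.IsSquare a b c d)
    {p r : X.skeleton.Walk c o} (hp : NormalForm p r) :
    ∃ s s', NormalForm (.cons hab (.cons hbc p)) s ∧ NormalForm (.cons had (.cons hdc p)) s' ∧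
      SwapEq s s' := by
  by_cases hb : ∃ q : X.skeleton.Walk b o, Ladder r q <;>
    by_cases hd : ∃ q : X.skeleton.Walk d o, Ladder r q
  · obtain ⟨q, hq⟩ := hb
    obtain ⟨q', hq'⟩ := hd
    obtain ⟨q'', hq'', he⟩ := hq'.transport hX (hq.swapEq hbc.symm)
    cases hq'' with
    | base => exact absurd rfl hsq.2.2.2.2.2.1
    | step hu hv hs hl =>
      rename_i x _
      obtain rfl : x = a := hs.rotate.rotate.rotate.unique_opposite hsq.rotate.rotate.reflect
      obtain ⟨t, ht, he'⟩ := (Ladder.base hv _).transport hX he.symm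
      exact ⟨_, _, .cancel _ (.cancel _ hp hq) hl, .cancel _ (.cancel _ hp hq') ht, he'⟩
  · obtain ⟨q, hq⟩ := hb
    obtain ⟨h1, h2⟩ := square_aux hX hab hbc had hdc hsq hp hq fun q hq => hd ⟨q, hq⟩
    exact ⟨_, _, h1, h2, .refl _⟩
  · obtain ⟨q, hq⟩ := hd
    obtain ⟨h1, h2⟩ := square_aux hX had hdc hab hbc hsq.reflect hp hq fun q hq => hb ⟨q, hq⟩
    exact ⟨_, _, h2, h1, .refl _⟩
  · refine ⟨_, _, .push hab (.push hbc hp fun q hq => hb ⟨q, hq⟩) fun q hq => ?_,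
      .push had (.push hdc hp fun q hq => hd ⟨q, hq⟩) fun q hq => ?_,
      .tail .refl (.head _ _ _ _ hsq _)⟩
    · cases hq with
      | base => exact hsq.2.2.2.2.1 rfl
      | step hu hv hs hl =>
        obtain rfl := hs.rotate.rotate.rotate.unique_opposite hsq.rotate
        exact hd ⟨_, hl⟩
    · cases hq with
      | base => exact hsq.2.2.2.2.1 rfl
      | step hu hv hs hl =>
        obtain rfl := hs.rotate.rotate.rotate.unique_opposite hsq.reflect.rotate
        exact hb ⟨_, hl⟩

/-- Homotopic walks have the same normal forms, up to square pushes. -/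
theorem Homotopic.swapEq (hX : X.IsNonpositivelyCurved) {u : V} {p p' : X.skeleton.Walk u o}
    (h : X.Homotopic p p') : ∀ r r', NormalForm p r → NormalForm p' r' → SwapEq r r' := by
  induction h with
  | refl p => exact NormalForm.unique hX p
  | symm _ ih => exact fun r r' h h' => (ih r' r h' h).symm
  | @trans _ _ p q r _ _ ih1 ih2 =>
    intro s s' h h'
    obtain ⟨t, ht⟩ := NormalForm.exists q
    exact (ih1 _ _ h ht).trans (ih2 _ _ ht h')
  | cons hu _ ih => exact fun r r' hr hr' => hr.cons_congr hX hu ih hr'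
  | backtrack hu hu' p =>
    intro r r' hr hr'
    obtain ⟨s, hs, he⟩ := hr'.backtrack hX hu hu'
    exact (NormalForm.unique hX _ _ _ hr hs).trans he
  | square hab hbc had hdc hsq p =>
    intro r r' hr hr'
    obtain ⟨t, ht⟩ := NormalForm.exists p
    obtain ⟨s, s', hs, hs', he⟩ := ht.square hX hab hbc had hdc hsq
    exact ((NormalForm.unique hX _ _ _ hr hs).trans he).trans (NormalForm.unique hX _ _ _ hs' hr')

theorem NormalForm.self_of_geodesic {u : V} {p : X.skeleton.Walk u o}
    (hp : p.length = X.skeleton.dist u o) : NormalForm p p := by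
  induction p with
  | nil => exact .nil
  | @cons u v w h p ih =>
    have h1 := SimpleGraph.dist_le p
    have h3 : X.skeleton.dist u w ≤ X.skeleton.dist v w + 1 := by
      obtain ⟨q, hq⟩ := p.reachable.exists_walk_length_eq_dist
      have := SimpleGraph.dist_le (SimpleGraph.Walk.cons h q)
      simpa [hq] using this
    simp only [SimpleGraph.Walk.length_cons] at hp
    refine .push h (ih (by omega)) fun q hq => ?_
    have h2 := SimpleGraph.dist_le q
    have := hq.length_eq
    omega

end walks

/-! ### Geodesics and the quadrangle condition -/

section homotopy

variable {u v w : V}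

theorem Homotopic.append_right {p q : X.skeleton.Walk u v} (h : X.Homotopic p q)
    (r : X.skeleton.Walk v w) : X.Homotopic (p.append r) (q.append r) := by
  induction h with
  | refl p => exact .refl _
  | symm _ ih => exact .symm (ih r)
  | trans _ _ ih1 ih2 => exact .trans (ih1 r) (ih2 r)
  | cons h _ ih => exact .cons h (ih r)
  | backtrack h h' p => exact .backtrack h h' _
  | square hab hbc had hdc hsq p => exact .square hab hbc had hdc hsq _

theorem Homotopic.append_left (p : X.skeleton.Walk u v) {q r : X.skeleton.Walk v w}
    (h : X.Homotopic q r) : X.Homotopic (p.append q) (p.append r) := by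
  induction p with
  | nil => exact h
  | cons h' p ih => exact .cons h' (ih h)

theorem homotopic_reverse_append (p : X.skeleton.Walk u v) (q : X.skeleton.Walk v w) :
    X.Homotopic (p.reverse.append (p.append q)) q := by
  induction p with
  | nil => exact .refl _
  | cons h p ih =>
    simp only [SimpleGraph.Walk.reverse_cons, SimpleGraph.Walk.cons_append,
      ← SimpleGraph.Walk.append_assoc, SimpleGraph.Walk.nil_append]
    exact .trans (.append_left _ (.backtrack _ _ _)) (ih q)

theorem IsSimplyConnected.homotopic (hX : X.IsSimplyConnected) (p q : X.skeleton.Walk u v) :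
    X.Homotopic p q := by
  have h1 := (hX.2 _ (p.append q.reverse)).append_right q
  have h2 := homotopic_reverse_append q.reverse q
  rw [← SimpleGraph.Walk.append_assoc, SimpleGraph.Walk.nil_append] at h1
  have h3 := homotopic_reverse_append q .nil
  simp only [SimpleGraph.Walk.append_nil] at h3
  exact .trans (.symm (by simpa using Homotopic.append_left p h3)) h1

theorem Homotopic.length_mod_two {p q : X.skeleton.Walk u v} (h : X.Homotopic p q) :
    p.length % 2 = q.length % 2 := by
  induction h with
  | refl p => rfl
  | symm _ ih => exact ih.symm
  | trans _ _ ih1 ih2 => exact ih1.trans ih2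
  | cons h _ ih => simp only [SimpleGraph.Walk.length_cons]; omega
  | backtrack h h' p => simp only [SimpleGraph.Walk.length_cons]; omega
  | square => simp only [SimpleGraph.Walk.length_cons]

end homotopy

/-- Two geodesics with the same ends differ by square pushes. -/
theorem IsCAT0.swapEq_of_geodesic (hX : X.IsCAT0) {u o : V} {p q : X.skeleton.Walk u o}
    (hp : p.length = X.skeleton.dist u o) (hq : q.length = X.skeleton.dist u o) : SwapEq p q :=
  (hX.2.homotopic p q).swapEq hX.1 _ _ (.self_of_geodesic hp) (.self_of_geodesic hq)

theorem IsCAT0.connected (hX : X.IsCAT0) : X.skeleton.Connected := hX.2.1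

/-- The one-skeleton is bipartite: distances to adjacent vertices differ. -/
theorem IsCAT0.dist_ne (hX : X.IsCAT0) {u v : V} (h : X.skeleton.Adj u v) (o : V) :
    X.skeleton.dist u o ≠ X.skeleton.dist v o := by
  obtain ⟨p, hp⟩ := (hX.connected u o).exists_walk_length_eq_dist
  obtain ⟨q, hq⟩ := (hX.connected v o).exists_walk_length_eq_dist
  have := (hX.2.homotopic p (.cons h q)).length_mod_two
  simp only [SimpleGraph.Walk.length_cons] at this
  omega

/-- The quadrangle condition: two neighbours of `v` closer to `o` than `v` span a square with `v`,
whose fourth vertex is still closer to `o`. -/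
theorem IsCAT0.quadrangle (hX : X.IsCAT0) {o v u w : V} (hu : X.skeleton.Adj v u)
    (hw : X.skeleton.Adj v w) (huw : u ≠ w)
    (hdu : X.skeleton.dist v o = X.skeleton.dist u o + 1)
    (hdw : X.skeleton.dist v o = X.skeleton.dist w o + 1) :
    ∃ x, X.IsSquare v u x w ∧ X.skeleton.dist u o = X.skeleton.dist x o + 1 := by
  obtain ⟨p, hp⟩ := (hX.connected u o).exists_walk_length_eq_dist
  obtain ⟨q, hq⟩ := (hX.connected w o).exists_walk_length_eq_dist
  have h1 : SwapEq (SimpleGraph.Walk.cons hu p) (.cons hw q) :=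
    hX.swapEq_of_geodesic (by simp [hp, hdu]) (by simp [hq, hdw])
  obtain ⟨q', hq', he⟩ := (Ladder.base hu p).transport hX.1 h1
  cases hq' with
  | base => exact absurd rfl huw
  | step hu' hv hs hl =>
    rename_i x r
    refine ⟨x, hs.rotate.rotate.rotate.reflect, ?_⟩
    have h2 := SimpleGraph.dist_le r
    have h3 := he.length_eq
    have h4 := (hX.connected).dist_triangle (u := u) (v := x) (w := o)
    have h5 := SimpleGraph.dist_eq_one_iff_adj.mpr hv
    simp only [SimpleGraph.Walk.length_cons] at h3
    omega

/-! ### Medians -/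

/-- A first step of a geodesic. -/
theorem IsCAT0.exists_adj_closer (hX : X.IsCAT0) {x y : V} (h : x ≠ y) :
    ∃ x', X.skeleton.Adj x x' ∧ X.skeleton.dist x y = X.skeleton.dist x' y + 1 := by
  obtain ⟨p, hp⟩ := (hX.connected x y).exists_walk_length_eq_dist
  cases p with
  | nil => exact absurd rfl h
  | @cons _ x' _ hx p =>
    refine ⟨x', hx, ?_⟩
    have h1 := SimpleGraph.dist_le p
    have h2 := hX.connected.dist_triangle (u := x) (v := x') (w := y)
    rw [SimpleGraph.dist_eq_one_iff_adj.mpr hx] at h2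
    rw [SimpleGraph.Walk.length_cons] at hp
    omega

theorem IsCAT0.dist_adj (hX : X.IsCAT0) {a b : V} (h : X.skeleton.Adj a b) (x : V) :
    X.skeleton.dist x b = X.skeleton.dist x a + 1 ∨
      X.skeleton.dist x a = X.skeleton.dist x b + 1 := by
  have h1 := hX.dist_ne h x
  have h2 := hX.connected.dist_triangle (u := x) (v := a) (w := b)
  have h3 := hX.connected.dist_triangle (u := x) (v := b) (w := a)
  rw [SimpleGraph.dist_eq_one_iff_adj.mpr h] at h2
  rw [SimpleGraph.dist_eq_one_iff_adj.mpr h.symm] at h3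
  rw [SimpleGraph.dist_comm (u := a), SimpleGraph.dist_comm (u := b)] at h1
  omega

/-- If `y` does not lie between `x` and `z`, then some neighbour of `y` is closer to both. -/
theorem IsCAT0.exists_adj_closer_both (hX : X.IsCAT0) {x y z : V}
    (h : X.skeleton.dist x z ≠ X.skeleton.dist x y + X.skeleton.dist y z) :
    ∃ y', X.skeleton.Adj y y' ∧ X.skeleton.dist y x = X.skeleton.dist y' x + 1 ∧
      X.skeleton.dist y z = X.skeleton.dist y' z + 1 := by
  induction hn : X.skeleton.dist y x generalizing y with
  | zero =>
    rw [(hX.connected y x).dist_eq_zero_iff] at hn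
    subst hn
    simp at h
  | succ n ih =>
    have hyx : y ≠ x := by rintro rfl; simp at hn
    obtain ⟨y₁, hy₁, hd⟩ := hX.exists_adj_closer hyx
    rcases hX.dist_adj hy₁ z with h1 | h1 <;>
      rw [SimpleGraph.dist_comm (u := z), SimpleGraph.dist_comm (u := z)] at h1
    · -- The step `y₁` towards `x` leads away from `z`: close up a square below `y₁`.
      obtain ⟨y₂, hy₂, hd₂, hd₂'⟩ := ih (y := y₁)
        (by rw [SimpleGraph.dist_comm (u := x)] at h ⊢; rw [SimpleGraph.dist_comm (v := y)] at h
            rw [SimpleGraph.dist_comm (v := y₁)]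
            omega) (by omega)
      have hne : y ≠ y₂ := by rintro rfl; omega
      obtain ⟨w, hw, hdw⟩ := hX.quadrangle hy₁.symm hy₂ hne h1 hd₂'
      refine ⟨w, hw.2.1, ?_, hdw⟩
      rcases hX.dist_adj hw.2.1 x with h2 | h2 <;> rcases hX.dist_adj hw.2.2.1 x with h3 | h3 <;>
        simp only [SimpleGraph.dist_comm (u := x)] at h2 h3 <;> omega
    · exact ⟨y₁, hy₁, by omega, h1⟩

/-- Any three vertices have a median point. -/
theorem IsCAT0.exists_isMedianPoint (hX : X.IsCAT0) (x y z : V) : ∃ m, X.IsMedianPoint x y z m := by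
  -- Starting at `y`, move towards `x` and `z` simultaneously for as long as possible.
  have key : ∀ n w, X.skeleton.dist w x = n →
      X.skeleton.dist y x = X.skeleton.dist y w + X.skeleton.dist w x →
      X.skeleton.dist y z = X.skeleton.dist y w + X.skeleton.dist w z →
      ∃ m, X.IsMedianPoint x y z m := by
    intro n
    induction n with
    | zero =>
      intro w hw h1 h2
      rw [(hX.connected w x).dist_eq_zero_iff] at hw
      subst hw
      refine ⟨w, ?_, ?_, h2⟩ <;> simp
    | succ n ih =>
      intro w hw h1 h2
      by_cases h : X.skeleton.dist x z = X.skeleton.dist x w + X.skeleton.dist w z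
      · exact ⟨w, by rw [SimpleGraph.dist_comm, h1, SimpleGraph.dist_comm (u := w),
          SimpleGraph.dist_comm (u := y), add_comm], h, h2⟩
      · obtain ⟨w', hw', h3, h4⟩ := hX.exists_adj_closer_both h
        have h5 := SimpleGraph.dist_eq_one_iff_adj.mpr hw'
        have h6 := hX.connected.dist_triangle (u := y) (v := w') (w := x)
        have h7 := hX.connected.dist_triangle (u := y) (v := w) (w := w')
        exact ih w' (by omega) (by omega) (by omega)
  exact key _ y rfl (by simp) (by simp)

/-! ### Sides of an edge and halfspaces -/

/-- The vertices closer to `a` than to `b`. -/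
def side (X : CubicalComplex V) (a b : V) : Set V :=
  {x | X.skeleton.dist x a < X.skeleton.dist x b}

theorem mem_side {a b x : V} : x ∈ X.side a b ↔ X.skeleton.dist x a < X.skeleton.dist x b :=
  Iff.rfl

theorem left_mem_side {a b : V} (h : X.skeleton.Adj a b) : a ∈ X.side a b := by
  rw [mem_side, SimpleGraph.dist_self, SimpleGraph.dist_eq_one_iff_adj.mpr h]
  exact one_pos

theorem IsCAT0.compl_side (hX : X.IsCAT0) {a b : V} (h : X.skeleton.Adj a b) :
    (X.side a b)ᶜ = X.side b a := by
  ext x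
  have := hX.dist_adj h x
  rw [mem_compl_iff, mem_side, mem_side]
  omega

theorem notMem_side {a b : V} : b ∉ X.side a b := by
  rw [mem_side, SimpleGraph.dist_self]
  omega

/-- Opposite edges of a square have the same sides. -/
theorem IsCAT0.side_subset_of_isSquare (hX : X.IsCAT0) {a b c d : V} (h : X.IsSquare a b c d) :
    X.side a b ⊆ X.side d c := by
  intro x hx
  by_contra hx'
  rw [mem_side] at hx hx'
  have hab := hX.dist_adj h.1 x
  have hbc := hX.dist_adj h.2.1 x
  have hcd := hX.dist_adj h.2.2.1 x
  have hda := hX.dist_adj h.2.2.2.1 x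
  simp only [SimpleGraph.dist_comm (u := x)] at *
  obtain ⟨y, hy, hdy⟩ := hX.quadrangle (o := x) h.1.symm h.2.1 h.2.2.2.2.1 (by omega) (by omega)
  -- The square at `b` found by the quadrangle condition is the given one.
  obtain rfl := hy.unique_opposite h.reflect.rotate.rotate.rotate
  omega

theorem IsCAT0.side_eq_of_isSquare (hX : X.IsCAT0) {a b c d : V} (h : X.IsSquare a b c d) :
    X.side a b = X.side d c :=
  (hX.side_subset_of_isSquare h).antisymm
    (hX.side_subset_of_isSquare h.rotate.reflect.rotate.rotate)

/-- The two sides of an edge, as a function of the unordered pair of its ends. -/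
def sides (X : CubicalComplex V) : Sym2 V → Set (Set V) :=
  Sym2.lift ⟨fun a b => {X.side a b, X.side b a}, fun _ _ => Set.pair_comm _ _⟩

theorem sides_mk (a b : V) : X.sides s(a, b) = {X.side a b, X.side b a} := rfl

theorem IsCAT0.sides_eq (hX : X.IsCAT0) {e f : Sym2 V} (h : Relation.EqvGen X.Parallel e f) :
    X.sides e = X.sides f ∧ (e ∈ X.skeleton.edgeSet ↔ f ∈ X.skeleton.edgeSet) := by
  induction h with
  | rel e f h =>
    obtain ⟨a, b, c, d, hs, rfl, rfl⟩ := h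
    rw [sides_mk, sides_mk, hX.side_eq_of_isSquare hs,
      hX.side_eq_of_isSquare hs.reflect.rotate.rotate.rotate]
    exact ⟨rfl, iff_of_true hs.1 hs.2.2.1.symm⟩
  | refl => exact ⟨rfl, Iff.rfl⟩
  | symm _ _ _ ih => exact ⟨ih.1.symm, ih.2.symm⟩
  | trans _ _ _ _ _ ih1 ih2 => exact ⟨ih1.1.trans ih2.1, ih1.2.trans ih2.2⟩

/-- An edge leading from one side of the edge `ab` to the other is parallel to `ab`. -/
theorem IsCAT0.eqvGen_of_crossing (hX : X.IsCAT0) {a b x y : V} (hab : X.skeleton.Adj a b)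
    (hxy : X.skeleton.Adj x y) (hx : x ∈ X.side a b) (hy : y ∈ X.side b a) :
    Relation.EqvGen X.Parallel s(a, b) s(x, y) := by
  induction hn : X.skeleton.dist x a generalizing x y with
  | zero =>
    rw [mem_side] at hx hy
    have h1 := hX.dist_adj hab y
    have h2 := hX.dist_adj hxy a
    rw [(hX.connected x a).dist_eq_zero_iff] at hn
    subst hn
    have : X.skeleton.dist y b = 0 := by
      simp only [SimpleGraph.dist_comm (u := x), SimpleGraph.dist_self] at *
      omega
    rw [(hX.connected y b).dist_eq_zero_iff] at this
    subst this
    exact .refl _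
  | succ n ih =>
    rw [mem_side] at hx hy
    have hne : x ≠ a := by rintro rfl; simp at hn
    obtain ⟨x', hx', hd⟩ := hX.exists_adj_closer hne
    have h1 := hX.dist_adj hab x
    have h2 := hX.dist_adj hab y
    have h3 := hX.dist_adj hab x'
    have h4 := hX.dist_adj hxy a
    have h5 := hX.dist_adj hxy b
    have h6 := hX.dist_adj hx' b
    simp only [SimpleGraph.dist_comm (u := a), SimpleGraph.dist_comm (u := b)] at h4 h5 h6
    have hyx' : y ≠ x' := by rintro rfl; omega
    obtain ⟨z, hz, hdz⟩ := hX.quadrangle (o := b) hxy hx' hyx' (by omega) (by omega)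
    have h7 := hX.dist_adj hab z
    have h8 := hX.dist_adj hz.2.1 a
    have h9 := hX.dist_adj hz.2.2.1 a
    simp only [SimpleGraph.dist_comm (u := a)] at h8 h9
    refine .trans _ _ _ (ih (x := x') (y := z) hz.2.2.1.symm ?_ ?_ (by omega))
      (.symm _ _ (.rel _ _ ⟨_, _, _, _, hz, rfl, rfl⟩))
    · rw [mem_side]; omega
    · rw [mem_side]; omega

theorem IsCAT0.side_eq_of_crossing (hX : X.IsCAT0) {a b x y : V} (hab : X.skeleton.Adj a b)
    (hxy : X.skeleton.Adj x y) (hx : x ∈ X.side a b) (hy : y ∉ X.side a b) :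
    X.side a b = X.side x y := by
  have hy' : y ∈ X.side b a := by rwa [← hX.compl_side hab]
  have h := (hX.sides_eq (hX.eqvGen_of_crossing hab hxy hx hy')).1
  rw [sides_mk, sides_mk] at h
  have h1 : X.side a b ∈ ({X.side x y, X.side y x} : Set (Set V)) := h ▸ by simp
  rcases h1 with h1 | h1
  · exact h1
  · exact absurd (h1 ▸ left_mem_side hxy.symm) hy

theorem IsCAT0.eqvGen_iff (hX : X.IsCAT0) {a b x y : V} (hab : X.skeleton.Adj a b) :
    Relation.EqvGen X.Parallel s(a, b) s(x, y) ↔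
      X.skeleton.Adj x y ∧ (x ∈ X.side a b ↔ y ∉ X.side a b) := by
  constructor
  · intro h
    obtain ⟨h1, h2⟩ := hX.sides_eq h
    have hxy : X.skeleton.Adj x y := h2.1 hab
    refine ⟨hxy, ?_⟩
    rw [sides_mk, sides_mk] at h1
    have h3 : X.side a b ∈ ({X.side x y, X.side y x} : Set (Set V)) := h1 ▸ by simp
    rcases h3 with h3 | h3 <;> rw [h3]
    · exact iff_of_true (left_mem_side hxy) notMem_side
    · exact iff_of_false notMem_side (not_not.2 (left_mem_side hxy.symm))
  · rintro ⟨hxy, h⟩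
    by_cases hx : x ∈ X.side a b
    · have hy : y ∈ X.side b a := by rw [← hX.compl_side hab]; exact h.1 hx
      exact hX.eqvGen_of_crossing hab hxy hx hy
    · have hy : y ∈ X.side a b := by tauto
      have hx' : x ∈ X.side b a := by rwa [← hX.compl_side hab]
      rw [Sym2.eq_swap (a := x)]
      exact hX.eqvGen_of_crossing hab hxy.symm hy hx'

/-- The hyperplane of an edge. -/
def hyperplane (X : CubicalComplex V) (a b : V) : Set (Sym2 V) :=
  {f | Relation.EqvGen X.Parallel s(a, b) f}

theorem IsCAT0.mem_hyperplane (hX : X.IsCAT0) {a b x y : V} (hab : X.skeleton.Adj a b) :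
    s(x, y) ∈ X.hyperplane a b ↔ X.skeleton.Adj x y ∧ (x ∈ X.side a b ↔ y ∉ X.side a b) :=
  hX.eqvGen_iff hab

theorem hyperplane_comm (a b : V) : X.hyperplane a b = X.hyperplane b a := by
  rw [hyperplane, hyperplane, Sym2.eq_swap]

theorem IsCAT0.reachable_side (hX : X.IsCAT0) {a b x : V} (hab : X.skeleton.Adj a b)
    (hx : x ∈ X.side a b) :
    (X.skeleton.deleteEdges (X.hyperplane a b)).Reachable x a := by
  induction hn : X.skeleton.dist x a generalizing x with
  | zero =>
    rw [(hX.connected x a).dist_eq_zero_iff] at hn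
    subst hn
    rfl
  | succ n ih =>
    have hne : x ≠ a := by rintro rfl; simp at hn
    obtain ⟨y, hy, hd⟩ := hX.exists_adj_closer hne
    have hy' : y ∈ X.side a b := by
      have h1 := hX.dist_adj hab x
      have h2 := hX.dist_adj hy b
      simp only [SimpleGraph.dist_comm (u := b)] at h2
      rw [mem_side] at hx ⊢
      omega
    refine .trans (SimpleGraph.Adj.reachable ?_) (ih hy' (by omega))
    rw [SimpleGraph.deleteEdges_adj, hX.mem_hyperplane hab]
    exact ⟨hy, fun h => h.2.1 hx hy'⟩

theorem IsCAT0.mem_side_iff_of_reachable (hX : X.IsCAT0) {a b x y : V} (hab : X.skeleton.Adj a b)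
    (h : (X.skeleton.deleteEdges (X.hyperplane a b)).Reachable x y) :
    x ∈ X.side a b ↔ y ∈ X.side a b := by
  obtain ⟨p⟩ := h
  induction p with
  | nil => rfl
  | cons h p ih =>
    rw [SimpleGraph.deleteEdges_adj, hX.mem_hyperplane hab] at h
    rw [← ih]
    tauto

theorem IsCAT0.supp_eq_side (hX : X.IsCAT0) {a b x : V} (hab : X.skeleton.Adj a b)
    (hx : x ∈ X.side a b) :
    ((X.skeleton.deleteEdges (X.hyperplane a b)).connectedComponentMk x).supp = X.side a b := by
  ext y
  rw [SimpleGraph.ConnectedComponent.mem_supp_iff, SimpleGraph.ConnectedComponent.eq]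
  exact ⟨fun h => (hX.mem_side_iff_of_reachable hab h).2 hx,
    fun h => (hX.reachable_side hab h).trans (hX.reachable_side hab hx).symm⟩

theorem IsCAT0.delimits_iff (hX : X.IsCAT0) {J : Set (Sym2 V)} {A : Set V} :
    X.Delimits J A ↔ ∃ a b, X.skeleton.Adj a b ∧ J = X.hyperplane a b ∧ A = X.side a b := by
  constructor
  · rintro ⟨⟨e, he, rfl⟩, c, rfl⟩
    induction e with | _ a b
    induction c using SimpleGraph.ConnectedComponent.ind with | _ x
    have hab : X.skeleton.Adj a b := he
    by_cases hx : x ∈ X.side a b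
    · exact ⟨a, b, hab, rfl, hX.supp_eq_side hab hx⟩
    · have hx' : x ∈ X.side b a := by rwa [← hX.compl_side hab]
      refine ⟨b, a, hab.symm, hyperplane_comm a b, ?_⟩
      have := hX.supp_eq_side hab.symm hx'
      rw [hyperplane_comm] at this
      exact this
  · rintro ⟨a, b, hab, rfl, rfl⟩
    exact ⟨⟨s(a, b), hab, rfl⟩, _, (hX.supp_eq_side hab (left_mem_side hab)).symm⟩

theorem IsCAT0.isHalfspace_iff (hX : X.IsCAT0) {A : Set V} :
    X.IsHalfspace A ↔ ∃ a b, X.skeleton.Adj a b ∧ A = X.side a b := by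
  constructor
  · rintro ⟨J, h⟩
    obtain ⟨a, b, hab, -, h⟩ := hX.delimits_iff.1 h
    exact ⟨a, b, hab, h⟩
  · rintro ⟨a, b, hab, h⟩
    exact ⟨_, hX.delimits_iff.2 ⟨a, b, hab, rfl, h⟩⟩

theorem IsCAT0.isHalfspace_side (hX : X.IsCAT0) {a b : V} (hab : X.skeleton.Adj a b) :
    X.IsHalfspace (X.side a b) := hX.isHalfspace_iff.2 ⟨a, b, hab, rfl⟩

theorem Delimits.isHalfspace {J : Set (Sym2 V)} {A : Set V} (h : X.Delimits J A) :
    X.IsHalfspace A := ⟨J, h⟩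

theorem IsCAT0.delimits_compl (hX : X.IsCAT0) {J : Set (Sym2 V)} {A : Set V}
    (h : X.Delimits J A) : X.Delimits J Aᶜ := by
  obtain ⟨a, b, hab, rfl, rfl⟩ := hX.delimits_iff.1 h
  exact hX.delimits_iff.2 ⟨b, a, hab.symm, hyperplane_comm a b, hX.compl_side hab⟩

theorem IsCAT0.isHalfspace_compl (hX : X.IsCAT0) {A : Set V} (h : X.IsHalfspace A) :
    X.IsHalfspace Aᶜ := by
  obtain ⟨J, h⟩ := h
  exact ⟨J, hX.delimits_compl h⟩

theorem IsCAT0.halfspace_nonempty (hX : X.IsCAT0) {A : Set V} (h : X.IsHalfspace A) :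
    A.Nonempty := by
  obtain ⟨a, b, hab, rfl⟩ := hX.isHalfspace_iff.1 h
  exact ⟨a, left_mem_side hab⟩

theorem IsCAT0.halfspace_eq_side (hX : X.IsCAT0) {A : Set V} (h : X.IsHalfspace A) {x y : V}
    (hxy : X.skeleton.Adj x y) (hx : x ∈ A) (hy : y ∉ A) : A = X.side x y := by
  obtain ⟨a, b, hab, rfl⟩ := hX.isHalfspace_iff.1 h
  exact hX.side_eq_of_crossing hab hxy hx hy

theorem IsCAT0.exists_delimits (hX : X.IsCAT0) {J : Set (Sym2 V)} (h : X.IsHyperplane J) :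
    ∃ A, X.Delimits J A := by
  obtain ⟨e, he, rfl⟩ := h
  induction e with | _ a b
  exact ⟨_, hX.delimits_iff.2 ⟨a, b, he, rfl, rfl⟩⟩

theorem IsCAT0.eq_or_eq_compl_of_delimits (hX : X.IsCAT0) {J : Set (Sym2 V)} {A B : Set V}
    (hA : X.Delimits J A) (hB : X.Delimits J B) : B = A ∨ B = Aᶜ := by
  obtain ⟨a, b, hab, rfl, rfl⟩ := hX.delimits_iff.1 hA
  obtain ⟨c, d, hcd, h, rfl⟩ := hX.delimits_iff.1 hB
  have h1 : s(c, d) ∈ X.hyperplane a b := h ▸ Relation.EqvGen.refl _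
  have h2 := (hX.sides_eq h1).1
  rw [sides_mk, sides_mk, ← hX.compl_side hab] at h2
  have h3 : X.side c d ∈ ({X.side a b, (X.side a b)ᶜ} : Set (Set V)) := h2 ▸ by simp
  exact h3

/-- Halfspaces are convex. -/
theorem IsCAT0.halfspace_convex (hX : X.IsCAT0) {A : Set V} (hA : X.IsHalfspace A) {x y z : V}
    (hx : x ∈ A) (hy : y ∈ A)
    (h : X.skeleton.dist x y = X.skeleton.dist x z + X.skeleton.dist z y) : z ∈ A := by
  induction hn : X.skeleton.dist x z generalizing x with
  | zero =>
    rw [(hX.connected x z).dist_eq_zero_iff] at hn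
    rwa [← hn]
  | succ n ih =>
    have hne : x ≠ z := by rintro rfl; simp at hn
    obtain ⟨x', hx', hd⟩ := hX.exists_adj_closer hne
    have h1 := hX.connected.dist_triangle (u := x') (v := z) (w := y)
    have h2 := hX.dist_adj hx' y
    simp only [SimpleGraph.dist_comm (u := y)] at h2
    refine ih (x := x') ?_ (by omega) (by omega)
    by_contra hxA
    rw [hX.halfspace_eq_side hA hx' hx hxA, mem_side] at hy
    simp only [SimpleGraph.dist_comm (u := y)] at hy
    omega

/-- The halfspaces containing `x` but not `y`. -/
def separators (X : CubicalComplex V) (x y : V) : Set (Set V) :=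
  {A | X.IsHalfspace A ∧ x ∈ A ∧ y ∉ A}

/-- The distance between two vertices counts the halfspaces separating them. -/
theorem IsCAT0.encard_separators (hX : X.IsCAT0) (x y : V) :
    (X.separators x y).encard = X.skeleton.dist x y := by
  induction hn : X.skeleton.dist x y generalizing x with
  | zero =>
    rw [(hX.connected x y).dist_eq_zero_iff] at hn
    subst hn
    simp only [Nat.cast_zero, encard_eq_zero]
    ext A
    simp [separators]
  | succ n ih =>
    have hne : x ≠ y := by rintro rfl; simp at hn
    obtain ⟨x', hx', hd⟩ := hX.exists_adj_closer hne
    have hy : y ∉ X.side x x' := by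
      rw [mem_side]
      simp only [SimpleGraph.dist_comm (u := y)]
      omega
    have hins : X.separators x y = insert (X.side x x') (X.separators x' y) := by
      ext A
      simp only [separators, mem_insert_iff, mem_ofPred_eq]
      constructor
      · rintro ⟨hA, hx, hy⟩
        by_cases h : x' ∈ A
        · exact .inr ⟨hA, h, hy⟩
        · exact .inl (hX.halfspace_eq_side hA hx' hx h)
      · rintro (rfl | ⟨hA, hx, hy'⟩)
        · exact ⟨hX.isHalfspace_side hx', left_mem_side hx', hy⟩
        · refine ⟨hA, ?_, hy'⟩
          by_contra h
          rw [hX.halfspace_eq_side hA hx'.symm hx h, ← hX.compl_side hx'] at hy'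
          exact hy' hy
    rw [hins, encard_insert_of_notMem (fun h => notMem_side h.2.1), ih x' (by omega)]
    simp

theorem IsCAT0.finite_separators (hX : X.IsCAT0) (x y : V) : (X.separators x y).Finite := by
  rw [← encard_lt_top_iff, hX.encard_separators]
  exact ENat.natCast_lt_top _

/-- A vertex lies on a geodesic from `x` to `z` when no halfspace separates it from both. -/
theorem IsCAT0.dist_eq_add_iff (hX : X.IsCAT0) {x y z : V} :
    X.skeleton.dist x z = X.skeleton.dist x y + X.skeleton.dist y z ↔
      ∀ A, X.IsHalfspace A → x ∈ A → z ∈ A → y ∈ A := by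
  refine ⟨fun h A hA hx hz => hX.halfspace_convex hA hx hz h, fun h => ?_⟩
  have hu : X.separators x z = X.separators x y ∪ X.separators y z := by
    ext A
    simp only [separators, mem_union, mem_ofPred_eq]
    constructor
    · rintro ⟨hA, hx, hz⟩
      tauto
    · rintro (⟨hA, hx, hy⟩ | ⟨hA, hy, hz⟩)
      · exact ⟨hA, hx, fun hz => hy (h A hA hx hz)⟩
      · refine ⟨hA, ?_, hz⟩
        by_contra hx
        exact h Aᶜ (hX.isHalfspace_compl hA) hx hz hy
  have hd : Disjoint (X.separators x y) (X.separators y z) :=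
    disjoint_left.2 fun A h1 h2 => h1.2.2 h2.2.1
  have := encard_union_eq hd
  rw [← hu, hX.encard_separators, hX.encard_separators, hX.encard_separators] at this
  exact_mod_cast this

theorem IsCAT0.eq_of_halfspaces (hX : X.IsCAT0) {x y : V}
    (h : ∀ A, X.IsHalfspace A → x ∈ A → y ∈ A) : x = y := by
  rw [← (hX.connected x y).dist_eq_zero_iff]
  have : X.separators x y = ∅ := by
    ext A
    simp only [separators, mem_ofPred_eq, mem_empty_iff_false, iff_false]
    rintro ⟨hA, hx, hy⟩
    exact hy (h A hA hx)
  have h2 := hX.encard_separators x y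
  rw [this, encard_empty] at h2
  exact_mod_cast h2.symm

theorem IsCAT0.isMedianPoint_median (hX : X.IsCAT0) (x y z : V) :
    X.IsMedianPoint x y z (X.median x y z) :=
  @Classical.epsilon_spec_aux V ⟨x⟩ _ (hX.exists_isMedianPoint x y z)

/-- A halfspace contains the median of three vertices when it contains two of them. -/
theorem IsCAT0.median_mem_iff (hX : X.IsCAT0) {x y z : V} {A : Set V} (hA : X.IsHalfspace A) :
    X.median x y z ∈ A ↔ (x ∈ A ∧ y ∈ A) ∨ (x ∈ A ∧ z ∈ A) ∨ (y ∈ A ∧ z ∈ A) := by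
  obtain ⟨h1, h2, h3⟩ := hX.isMedianPoint_median x y z
  rw [hX.dist_eq_add_iff] at h1 h2 h3
  have hA' := hX.isHalfspace_compl hA
  have k1 := h1 A hA
  have k2 := h2 A hA
  have k3 := h3 A hA
  have k4 := h1 Aᶜ hA'
  have k5 := h2 Aᶜ hA'
  have k6 := h3 Aᶜ hA'
  grind

/-! ### Orientations -/

theorem IsOrientation.mem_iff_compl (hX : X.IsCAT0) {σ : Set (Set V)} (h : X.IsOrientation σ)
    {A : Set V} (hA : X.IsHalfspace A) : A ∈ σ ↔ Aᶜ ∉ σ := by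
  obtain ⟨J, hJ⟩ := hA
  obtain ⟨B, ⟨hB, hBσ⟩, hu⟩ := h.existsUnique J hJ.1
  have hne : A ≠ Aᶜ := fun h => by
    obtain ⟨x, hx⟩ := hX.halfspace_nonempty hJ.isHalfspace
    exact (h ▸ hx : x ∈ Aᶜ) hx
  constructor
  · intro h1 h2
    exact hne ((hu A ⟨hJ, h1⟩).trans (hu _ ⟨hX.delimits_compl hJ, h2⟩).symm)
  · intro h1
    rcases hX.eq_or_eq_compl_of_delimits hJ hB with rfl | rfl
    · exact hBσ
    · exact absurd hBσ h1

theorem IsOrientation.compl_mem_iff (hX : X.IsCAT0) {σ : Set (Set V)} (h : X.IsOrientation σ)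
    {A : Set V} (hA : X.IsHalfspace A) : Aᶜ ∈ σ ↔ A ∉ σ := by
  rw [h.mem_iff_compl hX hA, not_not]

theorem IsCAT0.isOrientation_of (hX : X.IsCAT0) {σ : Set (Set V)}
    (h1 : ∀ A ∈ σ, X.IsHalfspace A) (h2 : ∀ A, X.IsHalfspace A → (A ∈ σ ↔ Aᶜ ∉ σ))
    (h3 : ∀ A B, X.IsHalfspace A → X.IsHalfspace B → A ⊆ B → A ∈ σ → B ∈ σ) :
    X.IsOrientation σ := by
  refine ⟨h1, fun J hJ => ?_, h3⟩
  obtain ⟨A, hA⟩ := hX.exists_delimits hJ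
  by_cases hσ : A ∈ σ
  · refine ⟨A, ⟨hA, hσ⟩, fun B hB => ?_⟩
    rcases hX.eq_or_eq_compl_of_delimits hA hB.1 with rfl | rfl
    · rfl
    · exact absurd hB.2 ((h2 A hA.isHalfspace).1 hσ)
  · refine ⟨Aᶜ, ⟨hX.delimits_compl hA, ?_⟩, fun B hB => ?_⟩
    · by_contra h
      exact hσ ((h2 A hA.isHalfspace).2 h)
    rcases hX.eq_or_eq_compl_of_delimits hA hB.1 with rfl | rfl
    · exact absurd hB.2 hσ
    · rfl

theorem mem_principal {x : V} {A : Set V} : A ∈ X.principal x ↔ X.IsHalfspace A ∧ x ∈ A := Iff.rfl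

theorem IsCAT0.isOrientation_principal (hX : X.IsCAT0) (x : V) :
    X.IsOrientation (X.principal x) := by
  refine hX.isOrientation_of (fun A hA => hA.1) (fun A hA => ?_) fun A B _ hB h hA => ⟨hB, h hA.2⟩
  simp [mem_principal, hA, hX.isHalfspace_compl hA]

/-- An orientation contained in another one is equal to it. -/
theorem IsOrientation.eq_of_subset (hX : X.IsCAT0) {σ τ : Set (Set V)} (hσ : X.IsOrientation σ)
    (hτ : X.IsOrientation τ) (h : σ ⊆ τ) : σ = τ := by
  refine h.antisymm fun A hA => ?_
  have hA' := hτ.isHalfspace A hA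
  rw [hσ.mem_iff_compl hX hA']
  exact fun hc => (hτ.mem_iff_compl hX hA').1 hA (h hc)

theorem IsOrientation.encard_diff_comm (hX : X.IsCAT0) {σ τ : Set (Set V)}
    (hσ : X.IsOrientation σ) (hτ : X.IsOrientation τ) : (σ \ τ).encard = (τ \ σ).encard := by
  have : τ \ σ = compl '' (σ \ τ) := by
    ext A
    constructor
    · rintro ⟨h1, h2⟩
      have hA := hτ.isHalfspace A h1
      exact ⟨Aᶜ, ⟨(hσ.compl_mem_iff hX hA).2 h2, (hτ.mem_iff_compl hX hA).1 h1⟩, compl_compl A⟩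
    · rintro ⟨B, ⟨h1, h2⟩, rfl⟩
      have hB := hσ.isHalfspace B h1
      exact ⟨(hτ.compl_mem_iff hX hB).2 h2, (hσ.mem_iff_compl hX hB).1 h1⟩
  rw [this, compl_injective.encard_image]

theorem IsOrientation.finite_diff_comm (hX : X.IsCAT0) {σ τ : Set (Set V)}
    (hσ : X.IsOrientation σ) (hτ : X.IsOrientation τ) (h : (σ \ τ).Finite) : (τ \ σ).Finite := by
  rw [← encard_lt_top_iff] at h ⊢
  rwa [hτ.encard_diff_comm hX hσ]

theorem finite_diff_trans {α : Type*} {ρ σ τ : Set α} (h : (ρ \ σ).Finite) (h' : (σ \ τ).Finite) :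
    (ρ \ τ).Finite :=
  (h.union h').subset fun A hA => by
    by_cases hs : A ∈ σ
    · exact .inr ⟨hs, hA.2⟩
    · exact .inl ⟨hA.1, hs⟩

/-- The set `σ` with the halfspace `A` replaced by its complement. It is an orientation when `σ` is
one and `A` is minimal in `σ`. -/
def flipHalfspace (σ : Set (Set V)) (A : Set V) : Set (Set V) := insert Aᶜ (σ \ {A})

theorem IsOrientation.flipHalfspace (hX : X.IsCAT0) {σ : Set (Set V)} (hσ : X.IsOrientation σ)
    {A : Set V} (hA : A ∈ σ) (hmin : ∀ B ∈ σ, B ⊆ A → B = A) :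
    X.IsOrientation (flipHalfspace σ A) := by
  have hA' := hσ.isHalfspace A hA
  have hne : A ≠ Aᶜ := fun h => by
    obtain ⟨x, hx⟩ := hX.halfspace_nonempty hA'
    exact (h ▸ hx : x ∈ Aᶜ) hx
  refine hX.isOrientation_of ?_ ?_ ?_
  · rintro B (rfl | hB)
    · exact hX.isHalfspace_compl hA'
    · exact hσ.isHalfspace B hB.1
  · intro B hB
    have h1 := hσ.mem_iff_compl hX hB
    have h2 := (hσ.mem_iff_compl hX hA').1 hA
    simp only [CubicalComplex.flipHalfspace, mem_insert_iff, Set.mem_sdiff, mem_singleton_iff,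
      compl_inj_iff]
    by_cases hBA : B = A
    · subst hBA; simp [hne]
    · by_cases hBA' : B = Aᶜ
      · subst hBA'; simp
        exact fun h => absurd h.symm hne
      · have : Bᶜ ≠ A := fun h => hBA' (by rw [← h, compl_compl])
        simp [hBA, hBA', this, h1]
  · intro B C hB hC hBC h
    simp only [CubicalComplex.flipHalfspace, mem_insert_iff, Set.mem_sdiff,
      mem_singleton_iff] at h ⊢
    by_cases hCA : C = Aᶜ
    · exact .inl hCA
    right
    rcases h with rfl | ⟨hBσ, hBA⟩
    · have hCσ : C ∈ σ := by
        rw [hσ.mem_iff_compl hX hC]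
        intro hc
        exact hCA (by rw [← hmin _ hc (compl_subset_comm.1 hBC), compl_compl])
      refine ⟨hCσ, ?_⟩
      rintro rfl
      obtain ⟨x, hx⟩ := hX.halfspace_nonempty hB
      exact hx (hBC hx)
    · refine ⟨hσ.upward B C hB hC hBC hBσ, ?_⟩
      rintro rfl
      exact hBA (hmin B hBσ hBC)

/-- An orientation that differs from a vertex on finitely many hyperplanes is a vertex. -/
theorem IsOrientation.exists_eq_principal (hX : X.IsCAT0) {σ : Set (Set V)}
    (hσ : X.IsOrientation σ) {x : V} (hfin : (σ \ X.principal x).Finite) :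
    ∃ v, σ = X.principal v := by
  induction hn : (σ \ X.principal x).ncard using Nat.strong_induction_on generalizing x with
  | _ n ih =>
  by_cases hempty : σ ⊆ X.principal x
  · exact ⟨x, hσ.eq_of_subset hX (hX.isOrientation_principal x) hempty⟩
  obtain ⟨A, hAσ, hxA⟩ := not_subset.1 hempty
  have hA := hσ.isHalfspace A hAσ
  replace hxA : x ∉ A := fun h => hxA ⟨hA, h⟩
  -- `y` is a point of `A` nearest to `x`, and `x'` the first step towards it.
  obtain ⟨y, hy, hmin⟩ : ∃ y ∈ A, ∀ z ∈ A, X.skeleton.dist x y ≤ X.skeleton.dist x z :=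
    ⟨_, Function.argminOn_mem (X.skeleton.dist x) A (hX.halfspace_nonempty hA),
      fun z hz => Function.argminOn_le (X.skeleton.dist x) A hz⟩
  have hxy : x ≠ y := by rintro rfl; exact hxA hy
  obtain ⟨x', hx', hd⟩ := hX.exists_adj_closer hxy
  have hyB : y ∈ X.side x' x := by
    rw [mem_side]
    simp only [SimpleGraph.dist_comm (u := y)]
    omega
  have hB := hX.isHalfspace_side hx'.symm
  have hBσ : X.side x' x ∈ σ := by
    rw [hσ.mem_iff_compl hX hB]
    intro hc
    obtain ⟨z, hzA, hzB⟩ : (A ∩ (X.side x' x)ᶜ).Nonempty := by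
      by_contra hne
      rw [not_nonempty_iff_eq_empty, ← disjoint_iff_inter_eq_empty, disjoint_compl_right_iff] at hne
      exact (hσ.compl_mem_iff hX hB).1 hc (hσ.upward A _ hA hB hne hAσ)
    obtain ⟨h1, -, -⟩ := hX.isMedianPoint_median x y z
    have h2 : X.median x y z ∈ A := (hX.median_mem_iff hA).2 (.inr (.inr ⟨hy, hzA⟩))
    have h3 : X.median x y z ∈ (X.side x' x)ᶜ :=
      (hX.median_mem_iff (hX.isHalfspace_compl hB)).2 (.inr (.inl ⟨notMem_side, hzB⟩))
    have h4 := hmin _ h2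
    have h5 : X.skeleton.dist (X.median x y z) y = 0 := by omega
    rw [(hX.connected _ y).dist_eq_zero_iff] at h5
    exact h3 (h5.symm ▸ hyB)
  have hsub : σ \ X.principal x' ⊂ σ \ X.principal x := by
    refine ⟨fun C hC => ⟨hC.1, fun hxC => ?_⟩, fun h => ?_⟩
    · have hx'C : x' ∉ C := fun h => hC.2 ⟨hxC.1, h⟩
      have := hC.1
      rw [hX.halfspace_eq_side hxC.1 hx' hxC.2 hx'C, ← hX.compl_side hx'.symm] at this
      exact (hσ.compl_mem_iff hX hB).1 this hBσ
    · exact (h ⟨hBσ, fun h => notMem_side h.2⟩).2 ⟨hB, left_mem_side hx'.symm⟩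
  exact ih _ (hn ▸ ncard_lt_ncard hsub hfin) (hfin.subset hsub.subset) rfl

theorem principal_diff (x y : V) :
    X.principal x \ X.principal y = X.separators x y := by
  ext A
  simp only [Set.mem_sdiff, mem_principal, separators, mem_ofPred_eq]
  tauto

/-- A halfspace that is minimal among those containing `x` is bounded by an edge at `x`. -/
theorem IsCAT0.exists_adj_of_minimal (hX : X.IsCAT0) {x : V} {A : Set V} (hA : X.IsHalfspace A)
    (hx : x ∈ A) (hmin : ∀ B, X.IsHalfspace B → x ∈ B → B ⊆ A → B = A) :
    ∃ x', X.skeleton.Adj x x' ∧ x' ∉ A := by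
  have hσ := hX.isOrientation_principal x
  have hflip := hσ.flipHalfspace hX ⟨hA, hx⟩ fun B hB => hmin B hB.1 hB.2
  have hsub : flipHalfspace (X.principal x) A \ X.principal x ⊆ {Aᶜ} := by
    rintro B ⟨rfl | hB, hB'⟩
    · rfl
    · exact absurd hB.1 hB'
  obtain ⟨x', hx'⟩ := hflip.exists_eq_principal hX ((finite_singleton _).subset hsub)
  have hx'A : x' ∉ A := (hx' ▸ mem_insert _ _ : Aᶜ ∈ X.principal x').2
  refine ⟨x', ?_, hx'A⟩
  have h1 : X.separators x x' = {A} := by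
    ext B
    rw [← principal_diff, ← hx', mem_singleton_iff]
    constructor
    · rintro ⟨h, h'⟩
      by_contra hne
      exact h' (.inr ⟨h, hne⟩)
    · rintro rfl
      exact ⟨⟨hA, hx⟩, by rw [hx']; exact fun h => hx'A h.2⟩
  have h2 := hX.encard_separators x x'
  rw [h1, encard_singleton] at h2
  exact SimpleGraph.dist_eq_one_iff_adj.1 (by exact_mod_cast h2.symm)

/-- A cubical component consists of the orientations differing on finitely many hyperplanes. -/
theorem IsCAT0.mem_cubicalComponent_iff (hX : X.IsCAT0) {ξ η : Set (Set V)}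
    (hξ : X.IsOrientation ξ) :
    η ∈ X.cubicalComponent ξ ↔ X.IsOrientation η ∧ (η \ ξ).Finite := by
  constructor
  · rintro ⟨h1, h2⟩
    refine ⟨h1, ?_⟩
    clear h1
    induction h2 with
    | refl => simp
    | tail _ h ih =>
      refine finite_diff_trans (finite_of_encard_le_coe (k := 2) ?_) ih
      rw [Nat.cast_ofNat, ← h.2.2]
      exact encard_le_encard fun A hA => .inr hA
  · rintro ⟨h1, h2⟩
    refine ⟨h1, ?_⟩
    induction hn : (η \ ξ).ncard using Nat.strong_induction_on generalizing η with
    | _ n ih =>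
    by_cases hsub : η ⊆ ξ
    · rw [h1.eq_of_subset hX hξ hsub]
    obtain ⟨A, hA, hmin⟩ := h2.exists_minimal (sdiff_nonempty.2 hsub)
    have hA' := h1.isHalfspace A hA.1
    have hAc : Aᶜ ∈ ξ := (hξ.compl_mem_iff hX hA').2 hA.2
    have hmin' : ∀ B ∈ η, B ⊆ A → B = A := by
      intro B hB hBA
      have hB' : B ∉ ξ := fun h => hA.2 (hξ.upward B A (h1.isHalfspace B hB) hA' hBA h)
      exact hBA.antisymm (hmin ⟨hB, hB'⟩ hBA)
    have hAcη : Aᶜ ∉ η := (h1.mem_iff_compl hX hA').1 hA.1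
    have hne : A ≠ Aᶜ := fun h => hAcη (h ▸ hA.1)
    have hflip := h1.flipHalfspace hX hA.1 hmin'
    have hss : flipHalfspace η A \ ξ ⊂ η \ ξ := by
      refine ⟨?_, fun h => ?_⟩
      · rintro B ⟨rfl | hB, hB'⟩
        · exact absurd hAc hB'
        · exact ⟨hB.1, hB'⟩
      · rcases (h hA).1 with h | h
        · exact hne h
        · exact h.2 rfl
    refine .tail (ih _ (hn ▸ ncard_lt_ncard hss h2) hflip (h2.subset hss.subset) rfl)
      ⟨hflip, h1, ?_⟩
    have : symmDiff (flipHalfspace η A) η = {A, Aᶜ} := by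
      ext B
      simp only [mem_symmDiff, CubicalComplex.flipHalfspace, mem_insert_iff, Set.mem_sdiff,
        mem_singleton_iff]
      constructor
      · tauto
      · rintro (rfl | rfl)
        · exact .inr ⟨hA.1, by simp [hne]⟩
        · exact .inl ⟨by simp, hAcη⟩
    rw [this, encard_pair hne]

/-! ### Medians and projections in the Roller compactification -/

theorem mem_rollerMedian {ρ σ τ : Set (Set V)} {A : Set V} : A ∈ rollerMedian ρ σ τ ↔
    (A ∈ ρ ∧ A ∈ σ) ∨ (A ∈ ρ ∧ A ∈ τ) ∨ (A ∈ σ ∧ A ∈ τ) := by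
  simp only [rollerMedian, mem_union, mem_inter_iff, or_assoc]

theorem IsOrientation.rollerMedian (hX : X.IsCAT0) {ρ σ τ : Set (Set V)} (hρ : X.IsOrientation ρ)
    (hσ : X.IsOrientation σ) (hτ : X.IsOrientation τ) :
    X.IsOrientation (CubicalComplex.rollerMedian ρ σ τ) := by
  refine hX.isOrientation_of (fun A hA => ?_) (fun A hA => ?_) (fun A B hA hB hAB h => ?_)
  · rw [mem_rollerMedian] at hA
    rcases hA with h | h | h
    · exact hρ.isHalfspace A h.1
    · exact hρ.isHalfspace A h.1
    · exact hσ.isHalfspace A h.1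
  · rw [mem_rollerMedian, mem_rollerMedian, hρ.compl_mem_iff hX hA, hσ.compl_mem_iff hX hA,
      hτ.compl_mem_iff hX hA]
    tauto
  · rw [mem_rollerMedian] at h ⊢
    have h1 := hρ.upward A B hA hB hAB
    have h2 := hσ.upward A B hA hB hAB
    have h3 := hτ.upward A B hA hB hAB
    tauto

theorem IsCAT0.principal_median (hX : X.IsCAT0) (x y z : V) :
    X.principal (X.median x y z) =
      CubicalComplex.rollerMedian (X.principal x) (X.principal y) (X.principal z) := by
  ext A
  rw [mem_rollerMedian, mem_principal, mem_principal, mem_principal, mem_principal]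
  constructor
  · rintro ⟨hA, h⟩
    rw [hX.median_mem_iff hA] at h
    tauto
  · intro h
    have hA : X.IsHalfspace A := by tauto
    exact ⟨hA, (hX.median_mem_iff hA).2 (by tauto)⟩

theorem IsCAT0.separatesFrom_iff (hX : X.IsCAT0) {J : Set (Sym2 V)} {A : Set V}
    (hJ : X.Delimits J A) {x : V} (hx : x ∈ A) {Y : Set (Set (Set V))} :
    X.SeparatesFrom J x Y ↔ ∀ η ∈ Y, Aᶜ ∈ η := by
  constructor
  · rintro ⟨B, C, hB, hC, hne, hxB, h⟩
    obtain rfl : B = A := by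
      rcases hX.eq_or_eq_compl_of_delimits hJ hB with rfl | rfl
      · rfl
      · exact absurd hx hxB.2
    rcases hX.eq_or_eq_compl_of_delimits hJ hC with rfl | rfl
    · exact absurd rfl hne
    · exact h
  · intro h
    exact ⟨A, Aᶜ, hJ, hX.delimits_compl hJ, fun h => (h ▸ hx : x ∈ Aᶜ) hx,
      ⟨hJ.isHalfspace, hx⟩, h⟩

theorem IsCAT0.isProjection_iff (hX : X.IsCAT0) {Y : Set (Set (Set V))} {x : V}
    {η : Set (Set V)} :
    X.IsProjection Y x η ↔
      η ∈ Y ∧ ∀ A, X.IsHalfspace A → x ∈ A → (Aᶜ ∈ η ↔ ∀ η' ∈ Y, Aᶜ ∈ η') := by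
  refine and_congr_right fun _ => ⟨fun h A ⟨J, hJ⟩ hx => ?_, fun h J => ?_⟩
  · have := h J
    rw [hX.separatesFrom_iff hJ hx, hX.separatesFrom_iff hJ hx] at this
    simpa using this
  · by_cases hJ : X.IsHyperplane J
    · obtain ⟨A, hA, hx⟩ : ∃ A, X.Delimits J A ∧ x ∈ A := by
        obtain ⟨A, hA⟩ := hX.exists_delimits hJ
        by_cases hx : x ∈ A
        · exact ⟨A, hA, hx⟩
        · exact ⟨Aᶜ, hX.delimits_compl hA, hx⟩
      rw [hX.separatesFrom_iff hA hx, hX.separatesFrom_iff hA hx]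
      simpa using h A hA.isHalfspace hx
    · exact iff_of_false (fun ⟨_, _, h, _⟩ => hJ h.1) (fun ⟨_, _, h, _⟩ => hJ h.1)

theorem IsCAT0.isProjection_unique (hX : X.IsCAT0) {Y : Set (Set (Set V))}
    (hY : Y ⊆ X.roller) {x : V} {η η' : Set (Set V)} (h : X.IsProjection Y x η)
    (h' : X.IsProjection Y x η') : η = η' := by
  rw [hX.isProjection_iff] at h h'
  have ho : X.IsOrientation η := hY h.1
  have ho' : X.IsOrientation η' := hY h'.1
  refine ho.eq_of_subset hX ho' fun A hA => ?_
  have hA' := ho.isHalfspace A hA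
  by_cases hx : x ∈ A
  · rw [ho'.mem_iff_compl hX hA', h'.2 A hA' hx, ← h.2 A hA' hx]
    exact (ho.mem_iff_compl hX hA').1 hA
  · have h1 := h.2 _ (hX.isHalfspace_compl hA') hx
    have h2 := h'.2 _ (hX.isHalfspace_compl hA') hx
    rw [compl_compl] at h1 h2
    exact h2.2 (h1.1 hA)

/-! ### Families of pairwise incomparable halfspaces -/

/-- Pairwise incomparable halfspaces whose intersection and whose complements' intersection are
nonempty are bounded by edges at a common vertex: choose `x` in all complements and `y` in all
halfspaces as close as possible; then the maximal halfspaces separating `y` from `x` all belong to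
the family. -/
theorem IsCAT0.card_le_of_incomparable (hX : X.IsCAT0) {N : ℕ}
    (hN : ∀ v : V, (X.skeleton.neighborSet v).encard ≤ N) {ι : Type*} [Fintype ι]
    {B : ι → Set V} (hB : ∀ i, X.IsHalfspace (B i)) (hinc : ∀ i j, B i ⊆ B j → i = j)
    {x₀ y₀ : V} (hx₀ : ∀ i, x₀ ∉ B i) (hy₀ : ∀ i, y₀ ∈ B i) : Fintype.card ι ≤ N := by
  let S : Set (V × V) := {p | (∀ i, p.1 ∉ B i) ∧ ∀ i, p.2 ∈ B i}
  let f : V × V → ℕ := fun p => X.skeleton.dist p.1 p.2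
  have hS : S.Nonempty := ⟨(x₀, y₀), hx₀, hy₀⟩
  obtain ⟨⟨x, y⟩, ⟨hx, hy⟩, hmin⟩ : ∃ p ∈ S, ∀ q ∈ S, f p ≤ f q :=
    ⟨_, Function.argminOn_mem f S hS, fun q hq => Function.argminOn_le f S hq⟩
  have key : ∀ i, ∃ x', X.skeleton.Adj x x' ∧ B i = X.side x' x := by
    intro i
    obtain ⟨M, hBM, hM⟩ := (hX.finite_separators y x).exists_le_maximal ⟨hB i, hy i, hx i⟩
    obtain ⟨hMh, hyM, hxM⟩ := hM.1
    obtain ⟨x', hadj, hx'⟩ := hX.exists_adj_of_minimal (hX.isHalfspace_compl hMh) hxM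
      fun C hC hxC hCM => by
        have hMC : M ⊆ Cᶜ := subset_compl_comm.1 hCM
        have := hM.2 ⟨hX.isHalfspace_compl hC, hMC hyM, not_not.2 hxC⟩ hMC
        rw [hMC.antisymm this, compl_compl]
    rw [notMem_compl_iff] at hx'
    have hMs := hX.halfspace_eq_side hMh hadj.symm hx' hxM
    refine ⟨x', hadj, ?_⟩
    -- By minimality of the pair, the edge from `x` to `x'` enters a member of the family.
    obtain ⟨j, hj⟩ : ∃ j, x' ∈ B j := by
      by_contra! h
      have h1 := hmin (x', y) ⟨h, hy⟩
      rw [hMs, mem_side] at hyM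
      simp only [f, SimpleGraph.dist_comm (v := y)] at h1
      omega
    have hjs := hX.halfspace_eq_side (hB j) hadj.symm hj (hx j)
    rw [hinc i j (by rw [hjs, ← hMs]; exact hBM), hjs]
  choose e he heB using key
  have hinj : Function.Injective e := fun i j h => hinc i j (by rw [heB i, heB j, h])
  have h1 : (range e).encard ≤ N :=
    (encard_le_encard (by rintro _ ⟨i, rfl⟩; exact he i)).trans (hN x)
  rw [← image_univ, hinj.encard_image, encard_univ, ENat.card_eq_coe_fintype_card] at h1
  exact_mod_cast h1

/-! ### Geodesic lines and their endpoints -/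

/-- A bi-infinite geodesic. -/
def IsLine (X : CubicalComplex V) (γ : ℤ → V) : Prop :=
  ∀ i j, (X.skeleton.dist (γ i) (γ j) : ℤ) = |i - j|

section line

variable {γ : ℤ → V} {A : Set V}

theorem IsLine.mem_of_le_of_le (hX : X.IsCAT0) (hγ : X.IsLine γ) (hA : X.IsHalfspace A)
    {i j k : ℤ} (hij : i ≤ j) (hjk : j ≤ k) (hi : γ i ∈ A) (hk : γ k ∈ A) : γ j ∈ A := by
  refine hX.halfspace_convex hA hi hk ?_
  have h1 := hγ i j
  have h2 := hγ j k
  have h3 := hγ i k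
  rw [abs_of_nonpos (by omega)] at h1 h2 h3
  omega

theorem IsLine.mem_or_notMem_atTop (hX : X.IsCAT0) (hγ : X.IsLine γ) (hA : X.IsHalfspace A) :
    (∀ᶠ i in atTop, γ i ∈ A) ∨ ∀ᶠ i in atTop, γ i ∉ A := by
  by_contra! h
  obtain ⟨i, -, hi⟩ := frequently_atTop.1 h.2 0
  obtain ⟨j, hij, hj⟩ := frequently_atTop.1 h.1 i
  obtain ⟨k, hjk, hk⟩ := frequently_atTop.1 h.2 j
  exact hj (hγ.mem_of_le_of_le hX hA hij hjk hi hk)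

theorem IsLine.mem_or_notMem_atBot (hX : X.IsCAT0) (hγ : X.IsLine γ) (hA : X.IsHalfspace A) :
    (∀ᶠ i in atBot, γ i ∈ A) ∨ ∀ᶠ i in atBot, γ i ∉ A := by
  by_contra! h
  obtain ⟨i, -, hi⟩ := frequently_atBot.1 h.2 0
  obtain ⟨j, hij, hj⟩ := frequently_atBot.1 h.1 i
  obtain ⟨k, hjk, hk⟩ := frequently_atBot.1 h.2 j
  exact hj (hγ.mem_of_le_of_le hX hA hjk hij hk hi)

theorem IsCAT0.isOrientation_endpoint_aux (hX : X.IsCAT0) {l : Filter ℤ} [l.NeBot]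
    (h : ∀ A, X.IsHalfspace A → (∀ᶠ i in l, γ i ∈ A) ∨ ∀ᶠ i in l, γ i ∉ A) :
    X.IsOrientation (X.endpoint γ l) := by
  refine hX.isOrientation_of (fun A hA => hA.1) (fun A hA => ?_)
    fun A B _ hB hAB hA => ⟨hB, hA.2.mono fun _ hi => hAB hi⟩
  constructor
  · rintro ⟨-, h1⟩ ⟨-, h2⟩
    obtain ⟨i, hi, hi'⟩ := (h1.and h2).exists
    exact hi' hi
  · intro h1
    rcases h A hA with h2 | h2
    · exact ⟨hA, h2⟩
    · exact absurd ⟨hX.isHalfspace_compl hA, h2⟩ h1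

theorem IsLine.isOrientation_atTop (hX : X.IsCAT0) (hγ : X.IsLine γ) :
    X.IsOrientation (X.endpoint γ atTop) :=
  hX.isOrientation_endpoint_aux fun _ hA => hγ.mem_or_notMem_atTop hX hA

theorem IsLine.isOrientation_atBot (hX : X.IsCAT0) (hγ : X.IsLine γ) :
    X.IsOrientation (X.endpoint γ atBot) :=
  hX.isOrientation_endpoint_aux fun _ hA => hγ.mem_or_notMem_atBot hX hA

theorem IsLine.mem_of_mem_endpoints (hX : X.IsCAT0) (hγ : X.IsLine γ)
    (h : A ∈ X.endpoint γ atBot) (h' : A ∈ X.endpoint γ atTop) (i : ℤ) : γ i ∈ A := by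
  obtain ⟨j, hj⟩ := Filter.eventually_atBot.1 h.2
  obtain ⟨k, hk⟩ := Filter.eventually_atTop.1 h'.2
  exact hγ.mem_of_le_of_le hX h.1 (min_le_right j i) (le_max_right k i) (hj _ (min_le_left _ _))
    (hk _ (le_max_left _ _))

theorem IsLine.mem_of_mem_atTop (hX : X.IsCAT0) (hγ : X.IsLine γ)
    (h : A ∈ X.endpoint γ atTop) {i j : ℤ} (hij : i ≤ j) (hi : γ i ∈ A) : γ j ∈ A := by
  obtain ⟨k, hk⟩ := Filter.eventually_atTop.1 h.2
  exact hγ.mem_of_le_of_le hX h.1 hij (le_max_right k j) hi (hk _ (le_max_left _ _))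

/-- A line meets a halfspace which contains only its positive end in a ray. -/
theorem IsLine.exists_ray (hX : X.IsCAT0) (hγ : X.IsLine γ)
    (h : A ∈ X.endpoint γ atTop) (h' : A ∉ X.endpoint γ atBot) :
    ∃ t : ℤ, ∀ i, γ i ∈ A ↔ t ≤ i := by
  have h1 : ∀ᶠ i in atBot, γ i ∉ A :=
    (hγ.mem_or_notMem_atBot hX h.1).resolve_left fun h2 => h' ⟨h.1, h2⟩
  obtain ⟨b, hb⟩ := Filter.eventually_atBot.1 h1
  obtain ⟨t, ht, hmin⟩ := Int.exists_least_of_bdd (P := fun i => γ i ∈ A)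
    ⟨b, fun i hi => by by_contra hlt; exact hb i (by omega) hi⟩ h.2.exists
  exact ⟨t, fun i => ⟨hmin i, fun hi => hγ.mem_of_mem_atTop hX h hi ht⟩⟩

theorem IsLine.neg (hγ : X.IsLine γ) : X.IsLine fun i => γ (-i) := fun i j => by
  rw [hγ, abs_sub_comm]
  congr 1
  ring

theorem endpoint_neg_atTop : X.endpoint (fun i => γ (-i)) atTop = X.endpoint γ atBot := by
  ext A
  refine and_congr_right fun _ => ?_
  rw [← Filter.map_neg_atTop (G := ℤ)]
  rfl

theorem IsLine.adj (hγ : X.IsLine γ) (i : ℤ) : X.skeleton.Adj (γ i) (γ (i + 1)) := by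
  rw [← SimpleGraph.dist_eq_one_iff_adj]
  have := hγ i (i + 1)
  rw [abs_of_nonpos (by omega)] at this
  omega

theorem IsLine.mem_side_iff (hγ : X.IsLine γ) (i j : ℤ) :
    γ j ∈ X.side (γ (i + 1)) (γ i) ↔ i + 1 ≤ j := by
  rw [mem_side]
  zify
  rw [hγ, hγ]
  rcases le_total j i with h | h
  · rw [abs_of_nonpos (by omega), abs_of_nonpos (by omega)]
    omega
  · rcases eq_or_lt_of_le h with rfl | h'
    · simp
    · rw [abs_of_nonneg (by omega), abs_of_nonneg (by omega)]
      omega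

/-- The endpoints of a line are not vertices: infinitely many hyperplanes cross a ray. -/
theorem IsLine.infinite_diff_principal (hX : X.IsCAT0) (hγ : X.IsLine γ) (v : V) :
    (X.endpoint γ atTop \ X.principal v).Infinite := by
  intro hfin
  have h2 : (X.endpoint γ atTop \ X.principal (γ 0)).Finite := by
    refine finite_diff_trans hfin ?_
    rw [principal_diff]
    exact hX.finite_separators _ _
  have hinj : Function.Injective fun n : ℕ => X.side (γ (n + 1)) (γ n) := by
    intro m n h
    have h3 : ∀ j, (m : ℤ) + 1 ≤ j ↔ (n : ℤ) + 1 ≤ j := fun j => by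
      rw [← hγ.mem_side_iff, ← hγ.mem_side_iff]
      exact iff_of_eq (congrArg (γ j ∈ ·) h)
    have h4 := h3 (m + 1)
    have h5 := h3 (n + 1)
    omega
  refine infinite_of_injective_forall_mem hinj (fun n => ?_) h2
  refine ⟨⟨hX.isHalfspace_side (hγ.adj n).symm, ?_⟩, fun h => ?_⟩
  · filter_upwards [Filter.eventually_ge_atTop ((n : ℤ) + 1)] with j hj
    exact (hγ.mem_side_iff _ _).2 hj
  · have := (hγ.mem_side_iff _ _).1 h.2
    omega

theorem IsLine.cubicalComponent_subset (hX : X.IsCAT0) (hγ : X.IsLine γ) :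
    X.cubicalComponent (X.endpoint γ atTop) ⊆ X.rollerBoundary := by
  intro η hη
  have hξ := hγ.isOrientation_atTop hX
  rw [hX.mem_cubicalComponent_iff hξ] at hη
  refine ⟨hη.1, ?_⟩
  rintro ⟨v, rfl⟩
  exact hγ.infinite_diff_principal hX v (hη.1.finite_diff_comm hX hξ hη.2)

theorem self_mem_cubicalComponent {ξ : Set (Set V)} (hξ : X.IsOrientation ξ) :
    ξ ∈ X.cubicalComponent ξ := ⟨hξ, .refl⟩

theorem IsLine.endpoint_atTop_mem (hX : X.IsCAT0) (hγ : X.IsLine γ) :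
    X.endpoint γ atTop ∈ X.rollerBoundary :=
  hγ.cubicalComponent_subset hX (self_mem_cubicalComponent (hγ.isOrientation_atTop hX))

theorem IsLine.endpoint_atBot_mem (hX : X.IsCAT0) (hγ : X.IsLine γ) :
    X.endpoint γ atBot ∈ X.rollerBoundary := by
  rw [← endpoint_neg_atTop]
  exact hγ.neg.endpoint_atTop_mem hX

end line

/-! ### Isometries and their axes -/

section isometry

variable {g : X.skeleton ≃g X.skeleton} {A : Set V}

theorem IsCAT0.dist_map (hX : X.IsCAT0) (g : X.skeleton ≃g X.skeleton) (x y : V) :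
    X.skeleton.dist (g x) (g y) = X.skeleton.dist x y := by
  have key : ∀ (h : X.skeleton ≃g X.skeleton) (x y : V),
      X.skeleton.dist (h x) (h y) ≤ X.skeleton.dist x y := fun h x y => by
    obtain ⟨p, hp⟩ := (hX.connected x y).exists_walk_length_eq_dist
    rw [← hp, ← SimpleGraph.Walk.length_map h.toHom p]
    exact SimpleGraph.dist_le _
  refine (key g x y).antisymm ?_
  simpa using key g⁻¹ (g x) (g y)

theorem IsCAT0.isHalfspace_preimage (hX : X.IsCAT0) (g : X.skeleton ≃g X.skeleton)
    (hA : X.IsHalfspace A) : X.IsHalfspace (g ⁻¹' A) := by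
  obtain ⟨a, b, hab, rfl⟩ := hX.isHalfspace_iff.1 hA
  refine hX.isHalfspace_iff.2 ⟨g.symm a, g.symm b, g.symm.map_rel_iff.2 hab, ?_⟩
  ext x
  rw [mem_preimage, mem_side, mem_side, ← hX.dist_map g x, ← hX.dist_map g x,
    RelIso.apply_symm_apply, RelIso.apply_symm_apply]

theorem zpow_add_apply (g : X.skeleton ≃g X.skeleton) (k l : ℤ) (x : V) :
    (g ^ (k + l)) x = (g ^ k) ((g ^ l) x) := by
  rw [zpow_add, RelIso.mul_apply]

theorem preimage_zpow_add (g : X.skeleton ≃g X.skeleton) (k l : ℤ) :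
    ⇑(g ^ (k + l)) ⁻¹' A = ⇑(g ^ l) ⁻¹' (⇑(g ^ k) ⁻¹' A) := by
  ext x
  simp only [mem_preimage, zpow_add_apply]

theorem preimage_zpow_zero (g : X.skeleton ≃g X.skeleton) :
    ⇑(g ^ (0 : ℤ)) ⁻¹' A = A := by
  ext x
  simp

theorem preimage_zpow_injective (g : X.skeleton ≃g X.skeleton) (k : ℤ) :
    Function.Injective fun A : Set V => ⇑(g ^ k) ⁻¹' A :=
  (g ^ k).surjective.preimage_injective

/-- A set invariant under `g ^ n` is invariant under the powers of `g ^ n`. -/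
theorem preimage_zpow_mul_eq {n : ℤ} (h : ⇑(g ^ n) ⁻¹' A = A) (k : ℤ) :
    ⇑(g ^ (n * k)) ⁻¹' A = A := by
  induction k using Int.induction_on with
  | zero => rw [mul_zero, preimage_zpow_zero]
  | succ k ih => rw [mul_add, mul_one, preimage_zpow_add, ih, h]
  | pred k ih =>
    refine preimage_zpow_injective g n ?_
    change ⇑(g ^ n) ⁻¹' (⇑(g ^ (n * (-k - 1))) ⁻¹' A) = ⇑(g ^ n) ⁻¹' A
    rw [← preimage_zpow_add, h, show n * (-k - 1) + n = n * -k by ring, ih]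

/-- The translates of `A` under the powers of `g` are pairwise distinct. -/
def HasDistinctTranslates (g : X.skeleton ≃g X.skeleton) (A : Set V) : Prop :=
  Function.Injective fun k : ℤ => ⇑(g ^ k) ⁻¹' A

theorem exists_periodic_of_not_hasDistinctTranslates (h : ¬ HasDistinctTranslates g A) :
    ∃ n : ℕ, 1 ≤ n ∧ ⇑(g ^ (n : ℤ)) ⁻¹' A = A := by
  obtain ⟨k, l, hkl, hne⟩ : ∃ k l : ℤ, ⇑(g ^ k) ⁻¹' A = ⇑(g ^ l) ⁻¹' A ∧ k < l := by
    simp only [HasDistinctTranslates, Function.Injective] at h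
    push Not at h
    obtain ⟨k, l, h1, h2⟩ := h
    rcases lt_or_gt_of_ne h2 with h3 | h3
    · exact ⟨k, l, h1, h3⟩
    · exact ⟨l, k, h1.symm, h3⟩
  refine ⟨(l - k).toNat, by omega, preimage_zpow_injective g k ?_⟩
  change ⇑(g ^ k) ⁻¹' (⇑(g ^ ((l - k).toNat : ℤ)) ⁻¹' A) = ⇑(g ^ k) ⁻¹' A
  rw [← preimage_zpow_add, Int.toNat_of_nonneg (by omega), sub_add_cancel, hkl]

theorem HasDistinctTranslates.of_orbit {z : V} {t : ℤ} (h : ∀ j : ℤ, (g ^ j) z ∈ A ↔ t ≤ j) :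
    HasDistinctTranslates g A := by
  have key : ∀ k j : ℤ, (g ^ j) z ∈ ⇑(g ^ k) ⁻¹' A ↔ t ≤ k + j := fun k j => by
    rw [mem_preimage, ← zpow_add_apply, h]
  intro k l hkl
  have h1 : ∀ j, t ≤ k + j ↔ t ≤ l + j := fun j => by
    rw [← key, ← key]
    exact iff_of_eq (congrArg ((g ^ j) z ∈ ·) hkl)
  have h2 := h1 (t - k)
  have h3 := h1 (t - l)
  omega

/-- Only finitely many translates of `A` separate two given vertices. -/
theorem HasDistinctTranslates.eventually_iff (hX : X.IsCAT0) (h : HasDistinctTranslates g A)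
    (hA : X.IsHalfspace A) (x y : V) : ∀ᶠ k : ℤ in cofinite, (g ^ k) x ∈ A ↔ (g ^ k) y ∈ A := by
  have hfin := ((hX.finite_separators x y).union (hX.finite_separators y x)).preimage h.injOn
  refine hfin.subset fun k hk => ?_
  have hk' : ¬ ((g ^ k) x ∈ A ↔ (g ^ k) y ∈ A) := hk
  have hAk := hX.isHalfspace_preimage (g ^ k) hA
  by_cases hx : (g ^ k) x ∈ A
  · exact .inl ⟨hAk, hx, fun hy => hk' (iff_of_true hx hy)⟩
  · exact .inr ⟨hAk, not_not.1 fun hy => hk' (iff_of_false hx hy), hx⟩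

/-- `g` translates the line `γ` in the positive direction by `τ`. -/
structure IsPositiveAxis (X : CubicalComplex V) (g : X.skeleton ≃g X.skeleton) (γ : ℤ → V)
    (τ : ℤ) : Prop where
  line : X.IsLine γ
  pos : 0 < τ
  map : ∀ i, g (γ i) = γ (i + τ)

namespace IsPositiveAxis

variable {γ : ℤ → V} {τ : ℤ}

theorem inv (h : X.IsPositiveAxis g γ τ) : X.IsPositiveAxis g⁻¹ (fun i => γ (-i)) τ where
  line := h.line.neg
  pos := h.pos
  map i := by
    have := h.map (-(i + τ))
    rw [show -(i + τ) + τ = -i by ring] at this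
    rw [← this, RelIso.inv_apply_self]

theorem zpow_apply (h : X.IsPositiveAxis g γ τ) (k i : ℤ) : (g ^ k) (γ i) = γ (i + k * τ) := by
  induction k using Int.induction_on generalizing i with
  | zero => simp
  | succ k ih => rw [zpow_add_apply, zpow_one, h.map, ih]; congr 1; ring
  | pred k ih =>
    have := h.inv.map (-i)
    simp only [neg_neg] at this
    rw [sub_eq_add_neg, zpow_add_apply, zpow_neg_one, this, ih]; congr 1; ring

theorem pow (h : X.IsPositiveAxis g γ τ) {n : ℕ} (hn : 1 ≤ n) :
    X.IsPositiveAxis (g ^ n) γ (n * τ) where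
  line := h.line
  pos := by have := h.pos; positivity
  map i := by rw [← zpow_natCast, h.zpow_apply]

theorem tendsto_atTop (h : X.IsPositiveAxis g γ τ) :
    Tendsto (fun k : ℤ => 0 + k * τ) atTop atTop := by
  simpa using tendsto_id.atTop_mul_const' h.pos

theorem tendsto_atBot (h : X.IsPositiveAxis g γ τ) :
    Tendsto (fun k : ℤ => 0 + k * τ) atBot atBot := by
  simpa using tendsto_id.atBot_mul_const' h.pos

theorem preimage_mem_atTop_iff (hX : X.IsCAT0) (h : X.IsPositiveAxis g γ τ)
    (k : ℤ) :
    ⇑(g ^ k) ⁻¹' A ∈ X.endpoint γ atTop ↔ A ∈ X.endpoint γ atTop := by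
  have key : ∀ (k : ℤ) (A : Set V), A ∈ X.endpoint γ atTop →
      ⇑(g ^ k) ⁻¹' A ∈ X.endpoint γ atTop := fun k A hA => by
    refine ⟨hX.isHalfspace_preimage _ hA.1, ?_⟩
    filter_upwards [(tendsto_atTop_add_const_right atTop (k * τ) tendsto_id).eventually hA.2]
      with i hi
    rw [mem_preimage, h.zpow_apply]
    exact hi
  refine ⟨fun hk => ?_, key k A⟩
  have := key (-k) _ hk
  rwa [← preimage_zpow_add, add_neg_cancel, preimage_zpow_zero] at this

theorem preimage_mem_atBot_iff (hX : X.IsCAT0) (h : X.IsPositiveAxis g γ τ)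
    (k : ℤ) :
    ⇑(g ^ k) ⁻¹' A ∈ X.endpoint γ atBot ↔ A ∈ X.endpoint γ atBot := by
  have := h.inv.preimage_mem_atTop_iff (A := A) hX (-k)
  rwa [endpoint_neg_atTop, inv_zpow, zpow_neg, inv_inv] at this

theorem exists_orbit_ray (hX : X.IsCAT0) (h : X.IsPositiveAxis g γ τ)
    (h1 : A ∈ X.endpoint γ atTop) (h2 : A ∉ X.endpoint γ atBot) :
    ∃ t : ℤ, ∀ j : ℤ, (g ^ j) (γ 0) ∈ A ↔ t ≤ j := by
  obtain ⟨t, ht⟩ := h.line.exists_ray hX h1 h2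
  refine ⟨-(-t / τ), fun j => ?_⟩
  rw [h.zpow_apply, ht, zero_add, neg_le, Int.le_ediv_iff_mul_le h.pos, neg_mul, neg_le_neg_iff]

theorem hasDistinctTranslates (hX : X.IsCAT0) (h : X.IsPositiveAxis g γ τ)
    (h1 : A ∈ X.endpoint γ atTop) (h2 : A ∉ X.endpoint γ atBot) : HasDistinctTranslates g A := by
  obtain ⟨t, ht⟩ := h.exists_orbit_ray hX h1 h2
  exact .of_orbit ht

/-- A halfspace crossed by the axis in the positive direction eventually contains the forward orbit
of every vertex, and eventually misses the backward orbit. -/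
theorem eventually_mem (hX : X.IsCAT0) (h : X.IsPositiveAxis g γ τ)
    (h1 : A ∈ X.endpoint γ atTop) (h2 : A ∉ X.endpoint γ atBot) (y : V) :
    (∀ᶠ k : ℤ in atTop, (g ^ k) y ∈ A) ∧ ∀ᶠ k : ℤ in atBot, (g ^ k) y ∉ A := by
  obtain ⟨t, ht⟩ := h.exists_orbit_ray hX h1 h2
  have h3 := (h.hasDistinctTranslates hX h1 h2).eventually_iff hX h1.1 (γ 0) y
  rw [Int.cofinite_eq, eventually_sup] at h3
  constructor
  · filter_upwards [h3.2, Filter.eventually_ge_atTop t] with k hk hk'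
    exact hk.1 ((ht k).2 hk')
  · filter_upwards [h3.1, Filter.eventually_lt_atBot t] with k hk hk' hy
    exact absurd ((ht k).1 (hk.2 hy)) (by omega)

/-- If an orbit crosses a halfspace once, in the positive direction, so does the axis. -/
theorem mem_endpoint_of_orbit (hX : X.IsCAT0) (h : X.IsPositiveAxis g γ τ)
    (hA : X.IsHalfspace A) {z : V} {t : ℤ} (hz : ∀ j : ℤ, (g ^ j) z ∈ A ↔ t ≤ j) :
    A ∈ X.endpoint γ atTop ∧ A ∉ X.endpoint γ atBot := by
  have h3 := (HasDistinctTranslates.of_orbit hz).eventually_iff hX hA (γ 0) z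
  rw [Int.cofinite_eq, eventually_sup] at h3
  constructor
  · rcases h.line.mem_or_notMem_atTop hX hA with h4 | h4
    · exact ⟨hA, h4⟩
    · obtain ⟨k, hk1, hk2, hk3⟩ := ((h.tendsto_atTop.eventually h4).and
        (h3.2.and (Filter.eventually_ge_atTop t))).exists
      rw [h.zpow_apply] at hk2
      exact absurd (hk2.2 ((hz k).2 hk3)) hk1
  · rintro ⟨-, h4⟩
    obtain ⟨k, hk1, hk2, hk3⟩ := ((h.tendsto_atBot.eventually h4).and
      (h3.1.and (Filter.eventually_lt_atBot t))).exists
    rw [h.zpow_apply] at hk2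
    exact absurd ((hz k).1 (hk2.1 hk1)) (by omega)

/-! ### The minimising sets -/

theorem dist_zpow_le (hX : X.IsCAT0) (g : X.skeleton ≃g X.skeleton) (x : V) (k : ℕ) :
    X.skeleton.dist x ((g ^ (k : ℤ)) x) ≤ k * X.skeleton.dist x (g x) := by
  induction k with
  | zero => simp
  | succ k ih =>
    have h1 := hX.connected.dist_triangle (u := x) (v := (g ^ (k : ℤ)) x)
      (w := (g ^ ((k + 1 : ℕ) : ℤ)) x)
    have h2 : X.skeleton.dist ((g ^ (k : ℤ)) x) ((g ^ ((k + 1 : ℕ) : ℤ)) x) =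
        X.skeleton.dist x (g x) := by
      rw [Nat.cast_succ, zpow_add_apply, zpow_one, hX.dist_map]
    rw [h2] at h1
    rw [add_mul, one_mul]
    omega

/-- Displacements grow at the same rate as those of the vertices of the axis. -/
theorem abs_dist_zpow_sub_le (hX : X.IsCAT0) (h : X.IsPositiveAxis g γ τ) (x : V) (k : ℕ) :
    |(X.skeleton.dist x ((g ^ (k : ℤ)) x) : ℤ) - k * τ| ≤ 2 * X.skeleton.dist x (γ 0) := by
  have h0 := h.line 0 (0 + k * τ)
  have hpos := h.pos
  rw [zero_sub, abs_neg, zero_add, abs_of_nonneg (by positivity)] at h0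
  have hz := h.zpow_apply k 0
  rw [zero_add] at hz
  rw [← hz] at h0
  have h1 := hX.dist_map (g ^ (k : ℤ)) x (γ 0)
  have h2 := hX.connected.dist_triangle (u := x) (v := γ 0) (w := (g ^ (k : ℤ)) x)
  have h3 := hX.connected.dist_triangle (u := γ 0) (v := (g ^ (k : ℤ)) (γ 0))
    (w := (g ^ (k : ℤ)) x)
  have h4 := hX.connected.dist_triangle (u := γ 0) (v := x) (w := (g ^ (k : ℤ)) (γ 0))
  have h5 := hX.connected.dist_triangle (u := x) (v := (g ^ (k : ℤ)) x)
    (w := (g ^ (k : ℤ)) (γ 0))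
  rw [SimpleGraph.dist_comm (u := (g ^ (k : ℤ)) (γ 0)) (v := (g ^ (k : ℤ)) x)] at h3
  rw [SimpleGraph.dist_comm (u := γ 0) (v := x)] at h4
  rw [abs_le]
  constructor <;> omega

theorem le_dist (hX : X.IsCAT0) (h : X.IsPositiveAxis g γ τ) (x : V) :
    τ ≤ X.skeleton.dist x (g x) := by
  by_contra! hlt
  set c := X.skeleton.dist x (γ 0)
  have h1 := (abs_le.1 (h.abs_dist_zpow_sub_le hX x (2 * c + 1))).1
  have h2 : ((X.skeleton.dist x ((g ^ ((2 * c + 1 : ℕ) : ℤ)) x) : ℕ) : ℤ) ≤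
      ((2 * c + 1 : ℕ) : ℤ) * X.skeleton.dist x (g x) := by
    exact_mod_cast dist_zpow_le hX g x (2 * c + 1)
  have h3 : ((2 * c + 1 : ℕ) : ℤ) * X.skeleton.dist x (g x) ≤ ((2 * c + 1 : ℕ) : ℤ) * (τ - 1) :=
    mul_le_mul_of_nonneg_left (by omega) (by positivity)
  rw [mul_sub, mul_one] at h3
  push_cast at *
  linarith

theorem mem_minSet_iff (hX : X.IsCAT0) (h : X.IsPositiveAxis g γ τ) {x : V} :
    x ∈ X.minSet g ↔ (X.skeleton.dist x (g x) : ℤ) = τ := by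
  have h0 : (X.skeleton.dist (γ 0) (g (γ 0)) : ℤ) = τ := by
    have hpos := h.pos
    rw [h.map, h.line, zero_sub, abs_neg, zero_add, abs_of_pos hpos]
  have hinf : ((⨅ y, X.skeleton.dist y (g y) : ℕ) : ℤ) = τ := by
    refine le_antisymm ?_ ?_
    · rw [← h0]
      exact_mod_cast ciInf_le (OrderBot.bddBelow _) (γ 0)
    · have : Nonempty V := ⟨γ 0⟩
      obtain ⟨y, hy⟩ := Nat.sInf_mem (range_nonempty fun y => X.skeleton.dist y (g y))
      rw [iInf, ← hy]
      exact h.le_dist hX y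
  rw [← hinf, Nat.cast_inj]
  rfl

theorem dist_zpow_eq (hX : X.IsCAT0) (h : X.IsPositiveAxis g γ τ) {x : V}
    (hx : (X.skeleton.dist x (g x) : ℤ) = τ) (k : ℕ) :
    (X.skeleton.dist x ((g ^ (k : ℤ)) x) : ℤ) = k * τ := by
  refine le_antisymm ?_ ?_
  · rw [← hx]
    exact_mod_cast dist_zpow_le hX g x k
  · rcases Nat.eq_zero_or_pos k with rfl | hk
    · simp
    · have := (h.pow hk).le_dist hX x
      rwa [← zpow_natCast] at this

/-- The orbit of a vertex of the minimising set is a geodesic sequence. -/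
theorem mem_of_orbit_between (hX : X.IsCAT0) (h : X.IsPositiveAxis g γ τ) {x : V}
    (hx : (X.skeleton.dist x (g x) : ℤ) = τ) (hA : X.IsHalfspace A) {i j k : ℤ} (hij : i ≤ j)
    (hjk : j ≤ k) (hi : (g ^ i) x ∈ A) (hk : (g ^ k) x ∈ A) : (g ^ j) x ∈ A := by
  have key : ∀ {i j : ℤ}, i ≤ j →
      (X.skeleton.dist ((g ^ i) x) ((g ^ j) x) : ℤ) = (j - i) * τ := fun {i j} hij => by
    have := h.dist_zpow_eq hX hx (j - i).toNat
    rw [Int.toNat_of_nonneg (by omega)] at this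
    rw [← this, ← hX.dist_map (g ^ i) x, ← zpow_add_apply, add_sub_cancel]
  refine hX.halfspace_convex hA hi hk ?_
  have h1 := key hij
  have h2 := key hjk
  have h3 := key (hij.trans hjk)
  zify
  rw [h1, h2, h3]
  ring

/-- The minimising set in terms of halfspaces: `x` is displaced minimally when it crosses only
hyperplanes crossed by the axis, and in the same direction. -/
theorem mem_minSet_iff_halfspaces (hX : X.IsCAT0) (h : X.IsPositiveAxis g γ τ) {x : V} :
    x ∈ X.minSet g ↔ ∀ A, X.IsHalfspace A → x ∉ A → g x ∈ A →
      A ∈ X.endpoint γ atTop ∧ A ∉ X.endpoint γ atBot := by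
  rw [h.mem_minSet_iff hX]
  constructor
  · intro hx A hA hxA hgA
    refine h.mem_endpoint_of_orbit hX hA (z := x) (t := 1) fun j => ⟨fun hj => ?_, fun hj => ?_⟩
    · by_contra! hlt
      refine hxA ?_
      simpa using h.mem_of_orbit_between hX hx hA (j := 0) (k := 1) (by omega) (by omega) hj
        (by simpa using hgA)
    · by_contra hj'
      have := h.mem_of_orbit_between hX hx (hX.isHalfspace_compl hA) (i := 0) (j := 1) (k := j)
        (by omega) (by omega) (by simpa using hxA) hj'
      exact this (by simpa using hgA)
  · intro H
    have step : ∀ A, X.IsHalfspace A → ∀ k : ℕ, (g ^ (k : ℤ)) x ∉ A →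
        (g ^ ((k + 1 : ℕ) : ℤ)) x ∈ A → A ∈ X.endpoint γ atTop ∧ A ∉ X.endpoint γ atBot := by
      intro A hA k h1 h2
      have := H _ (hX.isHalfspace_preimage (g ^ (k : ℤ)) hA) h1 (by
        rw [Nat.cast_succ, zpow_add_apply, zpow_one] at h2
        exact h2)
      rwa [h.preimage_mem_atTop_iff hX, h.preimage_mem_atBot_iff hX] at this
    have first : ∀ A, X.IsHalfspace A → x ∉ A → ∀ k : ℕ, (g ^ (k : ℤ)) x ∈ A →
        A ∈ X.endpoint γ atTop ∧ A ∉ X.endpoint γ atBot := by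
      intro A hA hxA k
      induction k with
      | zero => exact fun hk => absurd (by simpa using hk) hxA
      | succ k ih =>
        intro hk
        by_cases hk' : (g ^ (k : ℤ)) x ∈ A
        · exact ih hk'
        · exact step A hA k hk' hk
    have hdist : ∀ k : ℕ, X.skeleton.dist x ((g ^ (k : ℤ)) x) = k * X.skeleton.dist x (g x) := by
      intro k
      induction k with
      | zero => simp
      | succ k ih =>
        have h1 : X.skeleton.dist x ((g ^ ((k + 1 : ℕ) : ℤ)) x) =
            X.skeleton.dist x ((g ^ (k : ℤ)) x) +
              X.skeleton.dist ((g ^ (k : ℤ)) x) ((g ^ ((k + 1 : ℕ) : ℤ)) x) := by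
          refine hX.dist_eq_add_iff.2 fun A hA hx hk => ?_
          by_contra hk'
          -- The orbit would cross `A` outwards and then inwards.
          have h2 := step A hA k hk' hk
          have h3 := first Aᶜ (hX.isHalfspace_compl hA) (not_not.2 hx) k hk'
          exact ((h.line.isOrientation_atTop hX).mem_iff_compl hX hA).1 h2.1 h3.1
        rw [h1, ih, Nat.cast_succ, zpow_add_apply, zpow_one, hX.dist_map]
        ring
    refine le_antisymm ?_ (h.le_dist hX x)
    by_contra! hlt
    set c := X.skeleton.dist x (γ 0)
    have h1 := (abs_le.1 (h.abs_dist_zpow_sub_le hX x (2 * c + 1))).2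
    rw [hdist] at h1
    have h3 : ((2 * c + 1 : ℕ) : ℤ) * (τ + 1) ≤ ((2 * c + 1 : ℕ) : ℤ) * X.skeleton.dist x (g x) :=
      mul_le_mul_of_nonneg_left (by omega) (by positivity)
    rw [mul_add, mul_one] at h3
    push_cast at *
    linarith

end IsPositiveAxis

end isometry

/-! ### The cubical component of an endpoint -/

theorem IsCAT0.finite_ball (hX : X.IsCAT0) (hlf : X.IsUniformlyLocallyFinite) (v : V) (m : ℕ) :
    {x | X.skeleton.dist x v ≤ m}.Finite := by
  obtain ⟨N, hN⟩ := hlf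
  induction m with
  | zero =>
    refine (finite_singleton v).subset fun x hx => ?_
    exact (hX.connected x v).dist_eq_zero_iff.1 (Nat.le_zero.1 hx)
  | succ m ih =>
    refine (ih.union (ih.biUnion fun z _ => finite_of_encard_le_coe (hN z))).subset fun x hx => ?_
    by_cases hxv : x = v
    · subst hxv
      exact .inl (by simp)
    obtain ⟨x', hadj, hd⟩ := hX.exists_adj_closer hxv
    have hx' : X.skeleton.dist x v ≤ m + 1 := hx
    exact .inr (mem_biUnion (x := x') (show X.skeleton.dist x' v ≤ m by omega) hadj.symm)

namespace IsPositiveAxis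

variable {g : X.skeleton ≃g X.skeleton} {γ : ℤ → V} {τ : ℤ} {A : Set V} {η : Set (Set V)}

/-- If `η` differs from the endpoint `ξ` of the axis on finitely many hyperplanes, then flipping
these hyperplanes in a vertex far along the axis gives a vertex: so the halfspaces in `η \ ξ` stay
at bounded distance from the axis. -/
theorem exists_near (hX : X.IsCAT0) (h : X.IsPositiveAxis g γ τ) (hη : X.IsOrientation η)
    (hfin : (η \ X.endpoint γ atTop).Finite) :
    ∃ m : ℕ, ∃ i₀ : ℤ, ∀ i ≥ i₀, ∀ A ∈ η \ X.endpoint γ atTop,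
      ∃ x ∈ A, X.skeleton.dist x (γ i) ≤ m := by
  have hξ := h.line.isOrientation_atTop hX
  set ξ := X.endpoint γ atTop with hξdef
  -- From some index on, the axis has crossed every halfspace of `ξ` that contains a member of
  -- `η \ ξ`.
  obtain ⟨i₀, hi₀⟩ : ∃ i₀ : ℤ, ∀ i ≥ i₀, ∀ B ∈ η \ ξ, ∀ F ∈ ξ, B ⊆ F → γ i ∈ F := by
    have hne : ∀ B : ↥(η \ ξ), (B : Set V).Nonempty := fun B =>
      hX.halfspace_nonempty (hη.isHalfspace _ B.2.1)
    choose y hy using hne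
    have := hfin.to_subtype
    have hE : (⋃ B, X.separators (y B) (γ 0)).Finite :=
      finite_iUnion fun B => hX.finite_separators _ _
    have hev : ∀ᶠ i in atTop, ∀ F ∈ (⋃ B, X.separators (y B) (γ 0)) ∩ ξ, γ i ∈ F :=
      (eventually_all_finite (hE.subset inter_subset_left)).2 fun F hF => hF.2.2
    obtain ⟨i₁, hi₁⟩ := Filter.eventually_atTop.1 hev
    refine ⟨max i₁ 0, fun i hi B hB F hF hBF => ?_⟩
    by_cases h0 : γ 0 ∈ F
    · exact h.line.mem_of_mem_atTop hX hF (le_trans (le_max_right _ _) hi) h0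
    · exact hi₁ i (le_trans (le_max_left _ _) hi) F
        ⟨mem_iUnion.2 ⟨⟨B, hB⟩, hF.1, hBF (hy ⟨B, hB⟩), h0⟩, hF⟩
  obtain ⟨m, hm⟩ := hfin.exists_encard_eq_coe
  refine ⟨m, i₀, fun i hi A hA => ?_⟩
  have hmem : ∀ B ∈ η \ ξ, Bᶜ ∉ η \ ξ := fun B hB hB' =>
    (hη.mem_iff_compl hX (hη.isHalfspace B hB.1)).1 hB.1 hB'.1
  let σ : Set (Set V) := {B | X.IsHalfspace B ∧ (B ∈ η \ ξ ∨ γ i ∈ B ∧ Bᶜ ∉ η \ ξ)}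
  have hσ : X.IsOrientation σ := by
    refine hX.isOrientation_of (fun B hB => hB.1) (fun B hB => ?_) fun B F hB hF hBF h1 => ?_
    · simp only [σ, mem_ofPred_eq, compl_compl, hB, hX.isHalfspace_compl hB, true_and,
        mem_compl_iff]
      have := hmem B
      tauto
    · refine ⟨hF, ?_⟩
      by_cases hFD : F ∈ η \ ξ
      · exact .inl hFD
      right
      rcases h1.2 with h2 | ⟨h2, h3⟩
      · have hFη := hη.upward B F hB hF hBF h2.1
        have hFξ : F ∈ ξ := by
          by_contra hc
          exact hFD ⟨hFη, hc⟩
        exact ⟨hi₀ i hi B h2 F hFξ hBF,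
          fun hc => (hη.mem_iff_compl hX hF).1 hFη hc.1⟩
      · refine ⟨hBF h2, fun hc => ?_⟩
        have hBF' : Fᶜ ⊆ Bᶜ := compl_subset_compl.2 hBF
        have hBη := hη.upward _ _ (hX.isHalfspace_compl hF) (hX.isHalfspace_compl hB) hBF' hc.1
        have hBξ : Bᶜ ∈ ξ := by
          by_contra hcc
          exact h3 ⟨hBη, hcc⟩
        exact hi₀ i hi _ hc _ hBξ hBF' h2
  have hsub : σ \ X.principal (γ i) ⊆ η \ ξ := by
    rintro B ⟨⟨hB, hB1 | hB1⟩, hB2⟩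
    · exact hB1
    · exact absurd ⟨hB, hB1.1⟩ hB2
  obtain ⟨x, hx⟩ := hσ.exists_eq_principal hX (hfin.subset hsub)
  have hAx : A ∈ X.principal x := hx ▸ (⟨hη.isHalfspace A hA.1, .inl hA⟩ : A ∈ σ)
  refine ⟨x, hAx.2, ?_⟩
  have := encard_le_encard hsub
  rw [hx, principal_diff, hX.encard_separators, hm] at this
  exact_mod_cast this

/-- Halfspaces on which a point of the cubical component of `ξ` differs from `ξ` are invariant
under a power of `g`: infinitely many of their translates come close to a given vertex. -/
theorem exists_periodic (hX : X.IsCAT0) (hlf : X.IsUniformlyLocallyFinite)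
    (h : X.IsPositiveAxis g γ τ) (hη : X.IsOrientation η)
    (hfin : (η \ X.endpoint γ atTop).Finite) (hA : A ∈ η \ X.endpoint γ atTop) :
    ∃ n : ℕ, 1 ≤ n ∧ ⇑(g ^ (n : ℤ)) ⁻¹' A = A := by
  refine exists_periodic_of_not_hasDistinctTranslates fun hinj => ?_
  obtain ⟨m, i₀, hi₀⟩ := h.exists_near hX hη hfin
  have hAh := hη.isHalfspace A hA.1
  have hev : ∀ᶠ i in atTop, γ i ∉ A :=
    (h.line.mem_or_notMem_atTop hX hAh).resolve_left fun h2 => hA.2 ⟨hAh, h2⟩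
  have hfinite : (⋃ z ∈ {x | X.skeleton.dist x (γ 0) ≤ m}, X.separators z (γ 0)).Finite :=
    (hX.finite_ball hlf (γ 0) m).biUnion fun z _ => hX.finite_separators _ _
  have hcof : ∀ᶠ k : ℤ in atTop, ⇑(g ^ k) ⁻¹' A ∉
      ⋃ z ∈ {x | X.skeleton.dist x (γ 0) ≤ m}, X.separators z (γ 0) := by
    have : ∀ᶠ k : ℤ in cofinite, ⇑(g ^ k) ⁻¹' A ∉
        ⋃ z ∈ {x | X.skeleton.dist x (γ 0) ≤ m}, X.separators z (γ 0) := by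
      refine (hfinite.preimage hinj.injOn).subset fun k hk => ?_
      exact not_not.1 hk
    rw [Int.cofinite_eq, eventually_sup] at this
    exact this.2
  obtain ⟨k, hk1, hk2, hk3⟩ := (hcof.and ((h.tendsto_atTop.eventually hev).and
    (h.tendsto_atTop.eventually (Filter.eventually_ge_atTop i₀)))).exists
  obtain ⟨x, hxA, hd⟩ := hi₀ _ hk3 A hA
  refine hk1 (mem_biUnion (x := (g ^ k).symm x) ?_ ⟨hX.isHalfspace_preimage _ hAh, ?_, ?_⟩)
  · change X.skeleton.dist _ _ ≤ m
    rw [← hX.dist_map (g ^ k), h.zpow_apply, RelIso.apply_symm_apply]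
    exact hd
  · rw [mem_preimage, RelIso.apply_symm_apply]
    exact hxA
  · rw [mem_preimage, h.zpow_apply]
    exact hk2

end IsPositiveAxis

/-! ### Halfspaces crossed by the axis -/

/-- The line `γ` crosses the hyperplane bounding `A`: exactly one of its ends lies in `A`. -/
def Crosses (X : CubicalComplex V) (γ : ℤ → V) (A : Set V) : Prop :=
  ¬ (A ∈ X.endpoint γ atBot ↔ A ∈ X.endpoint γ atTop)

theorem crosses_of_mem_atTop {γ : ℤ → V} {A : Set V} (h1 : A ∈ X.endpoint γ atTop)
    (h2 : A ∉ X.endpoint γ atBot) : X.Crosses γ A := fun h => h2 (h.2 h1)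

theorem mem_stableMinSet {g : X.skeleton ≃g X.skeleton} {x : V} :
    x ∈ X.stableMinSet g ↔ ∃ n : ℕ, 1 ≤ n ∧ x ∈ X.minSet (g ^ n) := by
  simp only [stableMinSet, mem_iUnion, exists_prop]

namespace IsPositiveAxis

variable {g : X.skeleton ≃g X.skeleton} {γ : ℤ → V} {τ : ℤ} {A : Set V} {η : Set (Set V)}

theorem crosses_preimage_iff (hX : X.IsCAT0) (h : X.IsPositiveAxis g γ τ) (k : ℤ) :
    X.Crosses γ (⇑(g ^ k) ⁻¹' A) ↔ X.Crosses γ A := by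
  rw [Crosses, Crosses, h.preimage_mem_atTop_iff hX, h.preimage_mem_atBot_iff hX]

theorem crosses_compl_iff (hX : X.IsCAT0) (h : X.IsPositiveAxis g γ τ) (hA : X.IsHalfspace A) :
    X.Crosses γ Aᶜ ↔ X.Crosses γ A := by
  rw [Crosses, Crosses, (h.line.isOrientation_atTop hX).compl_mem_iff hX hA,
    (h.line.isOrientation_atBot hX).compl_mem_iff hX hA]
  tauto

/-- No orbit of a power of `g` stays in a halfspace crossed by the axis. -/
theorem exists_orbit_notMem (hX : X.IsCAT0) (h : X.IsPositiveAxis g γ τ) (hA : X.IsHalfspace A)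
    (hc : X.Crosses γ A) {n : ℕ} (hn : 1 ≤ n) (y : V) : ∃ k : ℤ, (g ^ (n * k)) y ∉ A := by
  by_cases h1 : A ∈ X.endpoint γ atTop
  · obtain ⟨K, hK⟩ := Filter.eventually_atBot.1
      (h.eventually_mem hX h1 (fun h2 => hc (iff_of_true h2 h1)) y).2
    refine ⟨-|K|, hK _ ?_⟩
    have h2 := neg_abs_le K
    have h3 : 1 * |K| ≤ (n : ℤ) * |K| :=
      mul_le_mul_of_nonneg_right (by exact_mod_cast hn) (abs_nonneg K)
    linarith
  · have h2 : A ∈ X.endpoint γ atBot := by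
      by_contra h2
      exact hc (iff_of_false h2 h1)
    have h1' := ((h.line.isOrientation_atTop hX).compl_mem_iff hX hA).2 h1
    have h2' := fun hh => ((h.line.isOrientation_atBot hX).compl_mem_iff hX hA).1 hh h2
    obtain ⟨K, hK⟩ := Filter.eventually_atTop.1 (h.eventually_mem hX h1' h2' y).1
    refine ⟨|K|, hK _ ?_⟩
    have h2 := le_abs_self K
    have h3 : 1 * |K| ≤ (n : ℤ) * |K| :=
      mul_le_mul_of_nonneg_right (by exact_mod_cast hn) (abs_nonneg K)
    linarith

theorem not_subset_of_periodic (hX : X.IsCAT0) (h : X.IsPositiveAxis g γ τ) {B : Set V}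
    (hB : X.IsHalfspace B) {n : ℕ} (hn : 1 ≤ n) (hper : ⇑(g ^ (n : ℤ)) ⁻¹' B = B)
    (hA : X.IsHalfspace A) (hc : X.Crosses γ A) : ¬ B ⊆ A := fun hBA => by
  obtain ⟨y, hy⟩ := hX.halfspace_nonempty hB
  obtain ⟨k, hk⟩ := h.exists_orbit_notMem hX hA hc hn y
  refine hk (hBA ?_)
  rw [← preimage_zpow_mul_eq hper k] at hy
  exact hy

theorem not_crosses_of_mem_diff (hX : X.IsCAT0) (hlf : X.IsUniformlyLocallyFinite)
    (h : X.IsPositiveAxis g γ τ) (hη : X.IsOrientation η)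
    (hfin : (η \ X.endpoint γ atTop).Finite) (hA : A ∈ η \ X.endpoint γ atTop) :
    ¬ X.Crosses γ A := fun hc => by
  have hAh := hη.isHalfspace A hA.1
  obtain ⟨n, hn, hper⟩ := h.exists_periodic hX hlf hη hfin hA
  exact h.not_subset_of_periodic hX hAh hn hper hAh hc subset_rfl

/-- On the hyperplanes crossed by the axis, the cubical component agrees with `ξ`. -/
theorem mem_iff_of_crosses (hX : X.IsCAT0) (hlf : X.IsUniformlyLocallyFinite)
    (h : X.IsPositiveAxis g γ τ) (hη : X.IsOrientation η)
    (hfin : (η \ X.endpoint γ atTop).Finite) (hA : X.IsHalfspace A) (hc : X.Crosses γ A) :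
    A ∈ η ↔ A ∈ X.endpoint γ atTop := by
  have hξ := h.line.isOrientation_atTop hX
  constructor
  · intro h1
    by_contra h2
    exact h.not_crosses_of_mem_diff hX hlf hη hfin ⟨h1, h2⟩ hc
  · intro h1
    rw [hη.mem_iff_compl hX hA]
    intro h2
    exact h.not_crosses_of_mem_diff hX hlf hη hfin ⟨h2, (hξ.mem_iff_compl hX hA).1 h1⟩
      ((h.crosses_compl_iff hX hA).2 hc)

/-- Uniform local finiteness makes a power of `g` shift the halfspaces crossed by the axis. -/
theorem exists_shift (hX : X.IsCAT0) (hlf : X.IsUniformlyLocallyFinite)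
    (h : X.IsPositiveAxis g γ τ) :
    ∃ N : ℕ, ∀ A, A ∈ X.endpoint γ atTop → A ∉ X.endpoint γ atBot →
      ∃ k : ℕ, 1 ≤ k ∧ k ≤ N ∧ A ⊆ ⇑(g ^ (k : ℤ)) ⁻¹' A := by
  obtain ⟨N, hN⟩ := hlf
  refine ⟨N, fun A h1 h2 => ?_⟩
  by_contra! hcon
  obtain ⟨t, ht⟩ := h.exists_orbit_ray hX h1 h2
  -- Otherwise the first `N + 1` translates of `A` are pairwise incomparable.
  have key : ∀ (k : ℕ) (j : ℤ), (g ^ j) (γ 0) ∈ ⇑(g ^ (k : ℤ)) ⁻¹' A ↔ t ≤ k + j := fun k j => by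
    rw [mem_preimage, ← zpow_add_apply, ht]
  have hcard := hX.card_le_of_incomparable hN (ι := Fin (N + 1))
    (B := fun k => ⇑(g ^ ((k : ℕ) : ℤ)) ⁻¹' A) (fun k => hX.isHalfspace_preimage _ h1.1)
    (fun i j hij => ?_) (x₀ := (g ^ (t - N - 1)) (γ 0)) (y₀ := (g ^ t) (γ 0))
    (fun i => by rw [key]; have := i.2; omega) (fun i => by rw [key]; omega)
  · simp at hcard
  · have hle : (i : ℕ) ≤ j := by
      have h3 := hij ((key i (t - i)).2 (by omega))
      rw [key] at h3
      omega
    by_contra hne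
    have hne' : (i : ℕ) ≠ j := fun h => hne (Fin.ext h)
    have hj := j.2
    refine hcon (j - i) (by omega) (by omega) ?_
    intro x hx
    have h4 := @hij ((g ^ ((i : ℕ) : ℤ)).symm x)
      (by rw [mem_preimage, RelIso.apply_symm_apply]; exact hx)
    rw [← Nat.sub_add_cancel hle, mem_preimage, Nat.cast_add, zpow_add_apply,
      RelIso.apply_symm_apply] at h4
    exact h4

theorem subset_preimage_zpow_mul {n : ℤ} (h : A ⊆ ⇑(g ^ n) ⁻¹' A) (k : ℕ) :
    A ⊆ ⇑(g ^ (n * k)) ⁻¹' A := by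
  induction k with
  | zero => simp
  | succ k ih =>
    rw [Nat.cast_succ, mul_add, mul_one, preimage_zpow_add]
    exact h.trans (preimage_mono ih)

theorem exists_uniform_shift (hX : X.IsCAT0) (hlf : X.IsUniformlyLocallyFinite)
    (h : X.IsPositiveAxis g γ τ) :
    ∃ n : ℕ, 1 ≤ n ∧ ∀ A, A ∈ X.endpoint γ atTop → A ∉ X.endpoint γ atBot →
      A ⊆ ⇑(g ^ (n : ℤ)) ⁻¹' A := by
  obtain ⟨N, hN⟩ := h.exists_shift hX hlf
  refine ⟨N.factorial, N.factorial_pos, fun A h1 h2 => ?_⟩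
  obtain ⟨k, hk1, hk2, hk3⟩ := hN A h1 h2
  obtain ⟨m, hm⟩ := Nat.dvd_factorial hk1 hk2
  rw [hm, Nat.cast_mul]
  exact subset_preimage_zpow_mul hk3 m

/-! ### The stable minimising set -/

theorem mem_minSet_pow_iff (hX : X.IsCAT0) (h : X.IsPositiveAxis g γ τ) {n : ℕ} (hn : 1 ≤ n)
    {x : V} : x ∈ X.minSet (g ^ n) ↔ ∀ A, X.IsHalfspace A → x ∉ A → (g ^ (n : ℤ)) x ∈ A →
      A ∈ X.endpoint γ atTop ∧ A ∉ X.endpoint γ atBot := by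
  rw [(h.pow hn).mem_minSet_iff_halfspaces hX, zpow_natCast]

theorem mem_minSet_mul (hX : X.IsCAT0) (h : X.IsPositiveAxis g γ τ) {m n : ℕ} (hm : 1 ≤ m)
    (hn : 1 ≤ n) {x : V} (hx : x ∈ X.minSet (g ^ m)) : x ∈ X.minSet (g ^ (m * n)) := by
  rw [(h.pow hm).mem_minSet_iff hX] at hx
  rw [(h.pow (Nat.mul_pos hm hn)).mem_minSet_iff hX]
  have := (h.pow hm).dist_zpow_eq hX hx n
  rw [zpow_natCast, ← pow_mul] at this
  rw [this]
  push_cast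
  ring

/-- The orbit of a vertex of the stable minimising set crosses only the hyperplanes crossed by the
axis. -/
theorem orbit_mem_iff (hX : X.IsCAT0) (h : X.IsPositiveAxis g γ τ) {n : ℕ} (hn : 1 ≤ n)
    {x : V} (hx : x ∈ X.minSet (g ^ n)) (hA : X.IsHalfspace A) (hc : ¬ X.Crosses γ A) (k : ℤ) :
    (g ^ (n * k)) x ∈ A ↔ x ∈ A := by
  rw [h.mem_minSet_pow_iff hX hn] at hx
  have step : ∀ B, X.IsHalfspace B → ¬ X.Crosses γ B → ((g ^ (n : ℤ)) x ∈ B ↔ x ∈ B) := by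
    intro B hB hc
    constructor
    · intro h1
      by_contra h2
      have := hx B hB h2 h1
      exact hc (crosses_of_mem_atTop this.1 this.2)
    · intro h1
      by_contra h2
      have := hx _ (hX.isHalfspace_compl hB) (not_not.2 h1) h2
      exact hc ((h.crosses_compl_iff hX hB).1 (crosses_of_mem_atTop this.1 this.2))
  have step' : ∀ k : ℤ, (g ^ (n * (k + 1))) x ∈ A ↔ (g ^ (n * k)) x ∈ A := fun k => by
    rw [mul_add, mul_one, zpow_add_apply]
    exact step _ (hX.isHalfspace_preimage (g ^ ((n : ℤ) * k)) hA)
      (fun hc' => hc ((h.crosses_preimage_iff hX _).1 hc'))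
  induction k using Int.induction_on with
  | zero => simp
  | succ k ih => exact (step' _).trans ih
  | pred k ih =>
    rw [← step', sub_add_cancel]
    exact ih

end IsPositiveAxis

namespace IsPositiveAxis

variable {g : X.skeleton ≃g X.skeleton} {γ : ℤ → V} {τ : ℤ} {A : Set V} {η : Set (Set V)}

/-! ### Projections to the cubical component -/

theorem mem_component_iff (hX : X.IsCAT0) (h : X.IsPositiveAxis g γ τ) :
    η ∈ X.cubicalComponent (X.endpoint γ atTop) ↔
      X.IsOrientation η ∧ (η \ X.endpoint γ atTop).Finite :=
  hX.mem_cubicalComponent_iff (h.line.isOrientation_atTop hX)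

/-- Uncrossed halfspaces containing `x` but not in `ξ` separate `x` from the axis, so they are
finitely many. -/
theorem finite_diff_of_subset (hX : X.IsCAT0) (h : X.IsPositiveAxis g γ τ) {σ : Set (Set V)}
    (hσ : ∀ A ∈ σ, X.IsHalfspace A) (x : V) (hsub : ∀ A ∈ σ, A ∉ X.endpoint γ atTop →
      x ∈ A ∧ ¬ X.Crosses γ A) : (σ \ X.endpoint γ atTop).Finite := by
  refine (hX.finite_separators x (γ 0)).subset fun A hA => ?_
  have hAh := hσ A hA.1
  obtain ⟨h1, h2⟩ := hsub A hA.1 hA.2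
  have h3 : A ∉ X.endpoint γ atBot := fun h3 => h2 fun h4 => hA.2 (h4.1 h3)
  refine ⟨hAh, h1, ?_⟩
  exact h.line.mem_of_mem_endpoints hX
    (((h.line.isOrientation_atBot hX).compl_mem_iff hX hAh).2 h3)
    (((h.line.isOrientation_atTop hX).compl_mem_iff hX hAh).2 hA.2) 0

theorem exists_isProjection (hX : X.IsCAT0) (hlf : X.IsUniformlyLocallyFinite)
    (h : X.IsPositiveAxis g γ τ) (x : V) :
    ∃ η, X.IsProjection (X.cubicalComponent (X.endpoint γ atTop)) x η := by
  have hξ := h.line.isOrientation_atTop hX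
  set Y := X.cubicalComponent (X.endpoint γ atTop) with hYdef
  have hξY : X.endpoint γ atTop ∈ Y := self_mem_cubicalComponent hξ
  have hYo : ∀ η ∈ Y, X.IsOrientation η := fun η hη => hη.1
  -- Where `Y` is not on one side of a hyperplane, the projection is on the side of `x`.
  let σ : Set (Set V) := {A | X.IsHalfspace A ∧ ((x ∈ A ∧ ∃ η ∈ Y, A ∈ η) ∨ ∀ η ∈ Y, A ∈ η)}
  have hσ : X.IsOrientation σ := by
    refine hX.isOrientation_of (fun A hA => hA.1) (fun A hA => ?_) fun A B hA hB hAB h1 => ?_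
    · have hc : ∀ η ∈ Y, (Aᶜ ∈ η ↔ A ∉ η) := fun η hη => (hYo η hη).compl_mem_iff hX hA
      constructor
      · rintro ⟨-, ⟨h1, η, hη, h2⟩ | h1⟩ ⟨-, ⟨h3, η', hη', h4⟩ | h3⟩
        · exact h3 h1
        · exact (hc η hη).1 (h3 η hη) h2
        · exact (hc η' hη').1 h4 (h1 η' hη')
        · exact (hc _ hξY).1 (h3 _ hξY) (h1 _ hξY)
      · intro h1
        refine ⟨hA, ?_⟩
        by_contra! h2
        obtain ⟨h2, η, hη, h3⟩ := h2
        refine h1 ⟨hX.isHalfspace_compl hA, ?_⟩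
        by_cases hx : x ∈ A
        · exact .inr fun η hη => (hc η hη).2 (h2 hx η hη)
        · exact .inl ⟨hx, η, hη, (hc η hη).2 h3⟩
    · refine ⟨hB, ?_⟩
      rcases h1.2 with ⟨h2, η, hη, h3⟩ | h2
      · exact .inl ⟨hAB h2, η, hη, (hYo η hη).upward A B hA hB hAB h3⟩
      · exact .inr fun η hη => (hYo η hη).upward A B hA hB hAB (h2 η hη)
  have hσY : σ ∈ Y := by
    refine (h.mem_component_iff hX).2 ⟨hσ, h.finite_diff_of_subset hX hσ.isHalfspace x ?_⟩
    rintro A ⟨hA, ⟨hx, η, hη, h1⟩ | h1⟩ h2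
    · obtain ⟨ho, hfin⟩ := (h.mem_component_iff hX).1 hη
      exact ⟨hx, h.not_crosses_of_mem_diff hX hlf ho hfin ⟨h1, h2⟩⟩
    · exact absurd (h1 _ hξY) h2
  refine ⟨σ, hX.isProjection_iff.2 ⟨hσY, fun A hA hx => ⟨?_, fun h1 => ?_⟩⟩⟩
  · rintro ⟨-, ⟨h1, -⟩ | h1⟩
    · exact absurd hx h1
    · exact h1
  · exact ⟨hX.isHalfspace_compl hA, .inr h1⟩

theorem isProjection_proj (hX : X.IsCAT0) (hlf : X.IsUniformlyLocallyFinite)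
    (h : X.IsPositiveAxis g γ τ) (x : V) :
    X.IsProjection (X.cubicalComponent (X.endpoint γ atTop)) x
      (X.proj (X.cubicalComponent (X.endpoint γ atTop)) x) :=
  Classical.epsilon_spec (h.exists_isProjection hX hlf x)

theorem existsUnique_isProjection (hX : X.IsCAT0) (hlf : X.IsUniformlyLocallyFinite)
    (h : X.IsPositiveAxis g γ τ) (x : V) :
    ∃! η, X.IsProjection (X.cubicalComponent (X.endpoint γ atTop)) x η := by
  obtain ⟨η, hη⟩ := h.exists_isProjection hX hlf x
  exact ⟨η, hη, fun η' hη' => hX.isProjection_unique (fun σ hσ => hσ.1) hη' hη⟩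

/-- The orientation obtained from the vertex `x` by turning all hyperplanes crossed by the line `γ`
towards its positive end. -/
def pushForward (X : CubicalComplex V) (γ : ℤ → V) (x : V) : Set (Set V) :=
  {A | X.IsHalfspace A ∧ ((X.Crosses γ A ∧ A ∈ X.endpoint γ atTop) ∨ (¬ X.Crosses γ A ∧ x ∈ A))}

/-- The forward orbit of a vertex of the stable minimising set converges to `pushForward`. -/
theorem isOrientation_pushForward (hX : X.IsCAT0) (h : X.IsPositiveAxis g γ τ) {x : V}
    (hx : x ∈ X.stableMinSet g) : X.IsOrientation (pushForward X γ x) := by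
  have hξ := h.line.isOrientation_atTop hX
  obtain ⟨n, hn, hxn⟩ := mem_stableMinSet.1 hx
  refine hX.isOrientation_of (fun A hA => hA.1) (fun A hA => ?_) fun A B hA hB hAB h1 => ?_
  · have h1 := hξ.compl_mem_iff hX hA
    by_cases hc : X.Crosses γ A <;>
      simp [pushForward, hA, hX.isHalfspace_compl hA, h.crosses_compl_iff hX hA, h1, hc]
  · refine ⟨hB, ?_⟩
    by_cases hcA : X.Crosses γ A <;> by_cases hcB : X.Crosses γ B
    · exact .inl ⟨hcB, hξ.upward A B hA hB hAB (by simpa [hcA] using h1.2)⟩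
    · -- `x ∉ B` would keep the orbit of `x` in the complement of `A`.
      refine .inr ⟨hcB, ?_⟩
      by_contra hxB
      obtain ⟨k, hk⟩ := h.exists_orbit_notMem hX (hX.isHalfspace_compl hA)
        ((h.crosses_compl_iff hX hA).2 hcA) hn x
      exact hxB ((h.orbit_mem_iff hX hn hxn hB hcB k).1 (hAB (not_not.1 hk)))
    · have hxA : x ∈ A := by simpa [hcA] using h1.2
      obtain ⟨k, hk⟩ := h.exists_orbit_notMem hX hB hcB hn x
      exact absurd (hAB ((h.orbit_mem_iff hX hn hxn hA hcA k).2 hxA)) hk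
    · have hxA : x ∈ A := by simpa [hcA] using h1.2
      exact .inr ⟨hcB, hAB hxA⟩

theorem proj_eq_pushForward (hX : X.IsCAT0) (hlf : X.IsUniformlyLocallyFinite)
    (h : X.IsPositiveAxis g γ τ) {x : V} (hx : x ∈ X.stableMinSet g) :
    X.proj (X.cubicalComponent (X.endpoint γ atTop)) x = pushForward X γ x := by
  have ho := h.isOrientation_pushForward hX hx
  refine hX.isProjection_unique (fun σ hσ => hσ.1) (h.isProjection_proj hX hlf x)
    (hX.isProjection_iff.2 ?_)
  have hmem : pushForward X γ x ∈ X.cubicalComponent (X.endpoint γ atTop) := by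
    refine (h.mem_component_iff hX).2 ⟨ho, h.finite_diff_of_subset hX ho.isHalfspace x ?_⟩
    rintro A ⟨hA, h1 | h1⟩ h2
    · exact absurd h1.2 h2
    · exact ⟨h1.2, h1.1⟩
  refine ⟨hmem, fun A hA hxA => ⟨?_, fun h1 => h1 _ hmem⟩⟩
  rintro ⟨hAc, ⟨hc, h1⟩ | ⟨hc, h1⟩⟩ η hη
  · obtain ⟨ho', hfin⟩ := (h.mem_component_iff hX).1 hη
    exact (h.mem_iff_of_crosses hX hlf ho' hfin hAc hc).2 h1
  · exact absurd hxA h1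

/-! ### The product decomposition -/

theorem isMedianSubalgebra (hX : X.IsCAT0) (h : X.IsPositiveAxis g γ τ) :
    X.IsMedianSubalgebra (X.stableMinSet g) := by
  intro x hx y hy z hz
  obtain ⟨a, ha, hxa⟩ := mem_stableMinSet.1 hx
  obtain ⟨b, hb, hyb⟩ := mem_stableMinSet.1 hy
  obtain ⟨c, hc, hzc⟩ := mem_stableMinSet.1 hz
  have hn : 1 ≤ a * b * c := Nat.mul_pos (Nat.mul_pos ha hb) hc
  have hx' : x ∈ X.minSet (g ^ (a * b * c)) := by
    rw [mul_assoc]; exact h.mem_minSet_mul hX ha (Nat.mul_pos hb hc) hxa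
  have hy' : y ∈ X.minSet (g ^ (a * b * c)) := by
    rw [mul_comm a b, mul_assoc]; exact h.mem_minSet_mul hX hb (Nat.mul_pos ha hc) hyb
  have hz' : z ∈ X.minSet (g ^ (a * b * c)) := by
    rw [mul_comm _ c]; exact h.mem_minSet_mul hX hc (Nat.mul_pos ha hb) hzc
  refine mem_stableMinSet.2 ⟨_, hn, ?_⟩
  rw [h.mem_minSet_pow_iff hX hn] at hx' hy' hz' ⊢
  -- `g` commutes with medians: a halfspace contains the image of the median when it contains two of
  -- the images.
  intro A hA h1 h2
  have h3 := (hX.median_mem_iff (x := x) (y := y) (z := z)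
    (hX.isHalfspace_preimage (g ^ ((a * b * c : ℕ) : ℤ)) hA)).1 h2
  rw [hX.median_mem_iff hA] at h1
  simp only [mem_preimage] at h3
  have k1 := hx' A hA
  have k2 := hy' A hA
  have k3 := hz' A hA
  grind

theorem rollerMedian_mem_interval (hX : X.IsCAT0) (h : X.IsPositiveAxis g γ τ) (x : V) :
    rollerMedian (X.principal x) (X.endpoint γ atBot) (X.endpoint γ atTop) ∈
      X.interval (X.endpoint γ atBot) (X.endpoint γ atTop) := by
  have hξ := h.line.isOrientation_atTop hX
  have hζ := h.line.isOrientation_atBot hX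
  have ho := (hX.isOrientation_principal x).rollerMedian hX hζ hξ
  refine ⟨?_, ?_⟩
  · obtain ⟨v, hv⟩ := ho.exists_eq_principal hX (x := x) (by
      refine (hX.finite_separators (γ 0) x).subset fun A hA => ?_
      have hAh := ho.isHalfspace A hA.1
      have h1 := hA.1
      rw [mem_rollerMedian] at h1
      have h2 := hA.2
      have h3 := h.line.mem_of_mem_endpoints (A := A) hX (by tauto) (by tauto) 0
      exact ⟨hAh, h3, fun hx => h2 ⟨hAh, hx⟩⟩)
    exact ⟨v, hv.symm⟩
  · ext A
    simp only [mem_rollerMedian]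
    tauto

/-- There is a vertex of the stable minimising set which is on the side of `v` of the hyperplanes
crossed by the axis, and on the side prescribed by `η` of the other ones. -/
theorem exists_mem_stableMinSet (hX : X.IsCAT0) (hlf : X.IsUniformlyLocallyFinite)
    (h : X.IsPositiveAxis g γ τ) (hη : X.IsOrientation η)
    (hfin : (η \ X.endpoint γ atTop).Finite) {v : V}
    (hv : rollerMedian (X.principal v) (X.endpoint γ atBot) (X.endpoint γ atTop) =
      X.principal v) :
    ∃ x ∈ X.stableMinSet g, ∀ A, X.IsHalfspace A →
      (x ∈ A ↔ (X.Crosses γ A ∧ v ∈ A) ∨ (¬ X.Crosses γ A ∧ A ∈ η)) := by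
  have hξ := h.line.isOrientation_atTop hX
  have hζ := h.line.isOrientation_atBot hX
  have hvmem : ∀ A, X.IsHalfspace A → A ∈ X.endpoint γ atBot → A ∈ X.endpoint γ atTop → v ∈ A :=
    fun A _ h1 h2 => (hv ▸ mem_rollerMedian.2 (.inr (.inr ⟨h1, h2⟩)) : A ∈ X.principal v).2
  -- The complement of an uncrossed halfspace `B` containing a crossed one is not in `η`, as
  -- it would be invariant under a power of `g`.
  have hup : ∀ A B, X.IsHalfspace A → X.IsHalfspace B → A ⊆ B → X.Crosses γ A →
      ¬ X.Crosses γ B → B ∈ η := by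
    intro A B hA hB hAB hcA hcB
    have hBξ : B ∈ X.endpoint γ atTop ∧ B ∈ X.endpoint γ atBot := by
      have h1 := hξ.upward A B hA hB hAB
      have h2 := hζ.upward A B hA hB hAB
      simp only [Crosses] at hcA hcB
      tauto
    rw [hη.mem_iff_compl hX hB]
    intro hBη
    obtain ⟨n, hn, hper⟩ := h.exists_periodic hX hlf hη hfin
      ⟨hBη, (hξ.mem_iff_compl hX hB).1 hBξ.1⟩
    exact h.not_subset_of_periodic hX (hX.isHalfspace_compl hB) hn hper
      (hX.isHalfspace_compl hA) ((h.crosses_compl_iff hX hA).2 hcA) (compl_subset_compl.2 hAB)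
  let σ : Set (Set V) := {A | X.IsHalfspace A ∧
    ((X.Crosses γ A ∧ v ∈ A) ∨ (¬ X.Crosses γ A ∧ A ∈ η))}
  have hσ : X.IsOrientation σ := by
    refine hX.isOrientation_of (fun A hA => hA.1) (fun A hA => ?_) fun A B hA hB hAB h1 => ?_
    · have h1 := hη.compl_mem_iff hX hA
      by_cases hc : X.Crosses γ A <;>
        simp [σ, hA, hX.isHalfspace_compl hA, h.crosses_compl_iff hX hA, h1, hc]
    · refine ⟨hB, ?_⟩
      by_cases hcA : X.Crosses γ A <;> by_cases hcB : X.Crosses γ B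
      · exact .inl ⟨hcB, hAB (by simpa [hcA] using h1.2)⟩
      · exact .inr ⟨hcB, hup A B hA hB hAB hcA hcB⟩
      · have hAη : A ∈ η := by simpa [hcA] using h1.2
        have := hup Bᶜ Aᶜ (hX.isHalfspace_compl hB) (hX.isHalfspace_compl hA)
          (compl_subset_compl.2 hAB) ((h.crosses_compl_iff hX hB).2 hcB)
          (fun hc => hcA ((h.crosses_compl_iff hX hA).1 hc))
        exact absurd hAη ((hη.compl_mem_iff hX hA).1 this)
      · exact .inr ⟨hcB, hη.upward A B hA hB hAB (by simpa [hcA] using h1.2)⟩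
  obtain ⟨x, hx⟩ := hσ.exists_eq_principal hX (x := v) (hfin.subset (by
    rintro A ⟨⟨hA, h1 | h1⟩, h2⟩
    · exact absurd ⟨hA, h1.2⟩ h2
    · refine ⟨h1.2, fun h3 => h2 ⟨hA, hvmem A hA ?_ h3⟩⟩
      by_contra h4
      exact h1.1 (crosses_of_mem_atTop h3 h4)))
  have hxmem : ∀ A, X.IsHalfspace A →
      (x ∈ A ↔ (X.Crosses γ A ∧ v ∈ A) ∨ (¬ X.Crosses γ A ∧ A ∈ η)) := fun A hA => by
    have : A ∈ σ ↔ A ∈ X.principal x := by rw [hx]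
    simpa [σ, mem_principal, hA] using this.symm
  refine ⟨x, ?_, hxmem⟩
  -- A power of `g` shifting the crossed halfspaces and preserving `η`.
  obtain ⟨a, ha, hshift⟩ := h.exists_uniform_shift hX hlf
  obtain ⟨b, hb, hper⟩ : ∃ b : ℕ, 1 ≤ b ∧ ∀ A ∈ η \ X.endpoint γ atTop,
      ⇑(g ^ (b : ℤ)) ⁻¹' A = A := by
    choose! p hp1 hp2 using fun A (hA : A ∈ η \ X.endpoint γ atTop) =>
      h.exists_periodic hX hlf hη hfin hA
    refine ⟨∏ A ∈ hfin.toFinset, p A,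
      Nat.one_le_iff_ne_zero.2 (Finset.prod_ne_zero_iff.2 fun A hA =>
        Nat.one_le_iff_ne_zero.1 (hp1 A (hfin.mem_toFinset.1 hA))), fun A hA => ?_⟩
    obtain ⟨m, hm⟩ := Finset.dvd_prod_of_mem p (hfin.mem_toFinset.2 hA)
    rw [hm, Nat.cast_mul]
    exact preimage_zpow_mul_eq (hp2 A hA) m
  have hn : 1 ≤ a * b := Nat.mul_pos ha hb
  refine mem_stableMinSet.2 ⟨a * b, hn, (h.mem_minSet_pow_iff hX hn).2 fun A hA h1 h2 => ?_⟩
  have hA' := hX.isHalfspace_preimage (g ^ ((a * b : ℕ) : ℤ)) hA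
  have hper' : ∀ B ∈ η \ X.endpoint γ atTop, ⇑(g ^ ((a * b : ℕ) : ℤ)) ⁻¹' B = B := fun B hB => by
    rw [mul_comm, Nat.cast_mul]
    exact preimage_zpow_mul_eq (hper B hB) a
  rw [hxmem A hA] at h1
  replace h2 := (hxmem _ hA').1 h2
  rw [h.crosses_preimage_iff hX] at h2
  by_cases hc : X.Crosses γ A
  · have hvA : v ∉ A := by tauto
    have hgv : v ∈ ⇑(g ^ ((a * b : ℕ) : ℤ)) ⁻¹' A := by tauto
    by_contra hcon
    -- Otherwise the complement of `A` is crossed in the positive direction.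
    have hc1 : Aᶜ ∈ X.endpoint γ atTop := by
      rw [hξ.compl_mem_iff hX hA]
      simp only [Crosses] at hc
      tauto
    have hc2 : Aᶜ ∉ X.endpoint γ atBot := by
      rw [hζ.compl_mem_iff hX hA]
      simp only [Crosses] at hc
      tauto
    have h5 := subset_preimage_zpow_mul (hshift _ hc1 hc2) b
    rw [← Nat.cast_mul] at h5
    exact h5 hvA hgv
  · exfalso
    have hAη : A ∉ η := by tauto
    have hgη : ⇑(g ^ ((a * b : ℕ) : ℤ)) ⁻¹' A ∈ η := by tauto
    have hAcη := (hη.compl_mem_iff hX hA).2 hAη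
    by_cases hAξ : A ∈ X.endpoint γ atTop
    · have h5 := hper' Aᶜ ⟨hAcη, (hξ.mem_iff_compl hX hA).1 hAξ⟩
      rw [preimage_compl, compl_inj_iff] at h5
      exact hAη (h5 ▸ hgη)
    · have h5 := hper' _ ⟨hgη, fun h6 => hAξ ((h.preimage_mem_atTop_iff hX _).1 h6)⟩
      have h6 := preimage_zpow_injective g _ h5
      exact hAη (h6 ▸ hgη)

theorem isMedianIsomorphism (hX : X.IsCAT0) (hlf : X.IsUniformlyLocallyFinite)
    (h : X.IsPositiveAxis g γ τ) :
    IsMedianIsomorphism X.median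
        (prodMedian CubicalComplex.rollerMedian CubicalComplex.rollerMedian)
        (X.stableMinSet g) (X.cubicalComponent (X.endpoint γ atTop) ×ˢ
          X.interval (X.endpoint γ atBot) (X.endpoint γ atTop))
        (fun x => (X.proj (X.cubicalComponent (X.endpoint γ atTop)) x,
          CubicalComplex.rollerMedian (X.principal x) (X.endpoint γ atBot)
            (X.endpoint γ atTop))) := by
  have hξ := h.line.isOrientation_atTop hX
  have hζ := h.line.isOrientation_atBot hX
  refine ⟨⟨fun x hx => ⟨(h.isProjection_proj hX hlf x).1, h.rollerMedian_mem_interval hX x⟩,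
    fun x hx y hy hxy => ?_, ?_⟩, fun x hx y hy z hz => ?_⟩
  · simp only [Prod.mk.injEq] at hxy
    rw [h.proj_eq_pushForward hX hlf hx, h.proj_eq_pushForward hX hlf hy] at hxy
    refine hX.eq_of_halfspaces fun A hA hxA => ?_
    have h1 : A ∈ pushForward X γ x ↔ A ∈ pushForward X γ y := by rw [hxy.1]
    have h2 := congrArg (A ∈ ·) hxy.2
    by_cases hc : X.Crosses γ A
    · simp only [mem_rollerMedian, mem_principal, hA, true_and, eq_iff_iff] at h2
      by_cases h3 : A ∈ X.endpoint γ atBot <;> by_cases h4 : A ∈ X.endpoint γ atTop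
      · exact absurd (iff_of_true h3 h4) hc
      · simpa [h3, h4, hxA] using h2
      · simpa [h3, h4, hxA] using h2
      · exact absurd (iff_of_false h3 h4) hc
    · simpa [pushForward, hA, hc, hxA] using h1
  · rintro ⟨η, σ⟩ ⟨hη, ⟨⟨v, hvσ⟩, hv⟩⟩
    change X.principal v = σ at hvσ
    subst hvσ
    change η ∈ _ at hη
    change rollerMedian _ _ _ = X.principal v at hv
    obtain ⟨ho, hfin⟩ := (h.mem_component_iff hX).1 hη
    obtain ⟨x, hx, hxA⟩ := h.exists_mem_stableMinSet hX hlf ho hfin hv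
    refine ⟨x, hx, Prod.ext ?_ ?_⟩
    · simp only
      rw [h.proj_eq_pushForward hX hlf hx]
      ext A
      by_cases hA : X.IsHalfspace A
      · have h1 := h.mem_iff_of_crosses hX hlf ho hfin hA
        by_cases hc : X.Crosses γ A
        · simp [pushForward, hA, hc, h1 hc]
        · simp [pushForward, hA, hc, hxA A hA]
      · exact iff_of_false (fun h => hA h.1) fun h => hA (ho.isHalfspace A h)
    · simp only
      rw [← hv]
      ext A
      by_cases hA : X.IsHalfspace A
      · by_cases h1 : A ∈ X.endpoint γ atBot <;> by_cases h2 : A ∈ X.endpoint γ atTop <;>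
          simp [mem_rollerMedian, mem_principal, hA, hxA A hA, Crosses, h1, h2]
      · refine iff_of_false (fun h => hA ?_) fun h => hA ?_ <;> rw [mem_rollerMedian] at h <;>
          rcases h with h | h | h
        exacts [h.1.1, h.1.1, h.1.1, h.1.1, h.1.1, h.1.1]
  · have hm := h.isMedianSubalgebra hX x hx y hy z hz
    simp only [prodMedian]
    rw [h.proj_eq_pushForward hX hlf hx, h.proj_eq_pushForward hX hlf hy,
      h.proj_eq_pushForward hX hlf hz, h.proj_eq_pushForward hX hlf hm, hX.principal_median]
    refine Prod.ext ?_ ?_ <;> ext A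
    · by_cases hA : X.IsHalfspace A
      · by_cases hc : X.Crosses γ A <;>
          simp [mem_rollerMedian, pushForward, hA, hc, hX.median_mem_iff hA]
      · simp only [mem_rollerMedian, pushForward, mem_ofPred_eq, hA, false_and, or_self]
    · by_cases h1 : A ∈ X.endpoint γ atBot <;> by_cases h2 : A ∈ X.endpoint γ atTop <;>
        simp [mem_rollerMedian, h1, h2]

end IsPositiveAxis

theorem stableMinSet_inv (hX : X.IsCAT0) (g : X.skeleton ≃g X.skeleton) :
    X.stableMinSet g⁻¹ = X.stableMinSet g := by
  have key : ∀ (n : ℕ) (y : V),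
      X.skeleton.dist y ((g⁻¹ ^ n) y) = X.skeleton.dist y ((g ^ n) y) := fun n y => by
    rw [← hX.dist_map (g ^ n), inv_pow, RelIso.apply_inv_self, SimpleGraph.dist_comm]
  simp only [stableMinSet, minSet, key]

end CubicalComplex

theorem mainTheorem4 {V : Type*} (X : CubicalComplex V) (hX : X.IsCAT0)
    (hlf : X.IsUniformlyLocallyFinite)
    (g : X.skeleton ≃g X.skeleton) (hg : X.IsLoxodromic g)
    (γ : ℤ → V) (hγ : X.IsAxis g γ)
    (ζ ξ : Set (Set V)) (hζ : ζ = X.endpoint γ atBot) (hξ : ξ = X.endpoint γ atTop)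
    (Y : Set (Set (Set V))) (hY : Y = X.cubicalComponent ξ) :
    ζ ∈ X.rollerBoundary ∧ ξ ∈ X.rollerBoundary ∧ Y ⊆ X.rollerBoundary ∧
      (∀ x, ∃! η, X.IsProjection Y x η) ∧
      X.IsMedianSubalgebra (X.stableMinSet g) ∧
      IsMedianIsomorphism X.median
        (prodMedian CubicalComplex.rollerMedian CubicalComplex.rollerMedian)
        (X.stableMinSet g) (Y ×ˢ X.interval ζ ξ)
        (fun x => (X.proj Y x, CubicalComplex.rollerMedian (X.principal x) ζ ξ)) := by
  subst hζ hξ hY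
  obtain ⟨hline, τ, hτ, hmap⟩ := hγ
  change X.IsLine γ at hline
  -- Replacing `g` by its inverse changes neither the stable minimising set nor the axis.
  obtain ⟨g', τ', hS, h⟩ : ∃ (g' : X.skeleton ≃g X.skeleton) (τ' : ℤ),
      X.stableMinSet g' = X.stableMinSet g ∧ X.IsPositiveAxis g' γ τ' := by
    rcases lt_or_gt_of_ne hτ with hτ | hτ
    · refine ⟨g⁻¹, -τ, CubicalComplex.stableMinSet_inv hX g, hline, by omega, fun i => ?_⟩
      rw [← sub_eq_add_neg, ← sub_add_cancel i τ, ← hmap, RelIso.inv_apply_self]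
      simp
    · exact ⟨g, τ, rfl, hline, hτ, hmap⟩
  rw [← hS]
  exact ⟨hline.endpoint_atBot_mem hX, hline.endpoint_atTop_mem hX,
    hline.cubicalComponent_subset hX, h.existsUnique_isProjection hX hlf,
    h.isMedianSubalgebra hX, h.isMedianIsomorphism hX hlf⟩
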